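/- Work over $\mathbb{C}$. Let $A$ and $H$ be Hopf algebras with bijective antipodes, let $\pi : A \to H$ be a surjective Hopf algebra homomorphism, and let $B = A^{\mathrm{co}(H)} = \{a \in A : (\mathrm{id}\otimes\pi)\Delta(a) = a \otimes 1\}$. Then $B$ is a left $A$-comodule algebra with coaction $\Delta|_B : B \to A \otimes B$. Assume that $B$ is a quantum homogeneous space, i.e. that $A$ is faithfully flat as a right $B$-module, and that $H$ is cosemisimple, i.e. a direct sum of simple subcoalgebras. Let ${}^A_B\mathrm{Mod}_B$ be the category whose objects are the $B$-bimodules $M$ with a left $A$-comodule structure $\delta_M : M \to A \otimes M$ such that $\delta_M(b m c) = \Delta(b)\,\delta_M(m)\,\Delta(c)$ for $b, c \in B$, $m \in M$, and whose morphisms are the $B$-bilinear left $A$-colinear maps; the tensor product $M \otimes_B N$ of two objects carries the diagonal coaction $m \otimes_B n \mapsto m_{(-1)} n_{(-1)} \otimes (m_{(0)} \otimes_B n_{(0)})$. Let ${}^A_B\mathrm{Mod}_0$ be the full subcategory of those $M$ that are finitely generated as left $B$-modules and satisfy $M B^+ = B^+ M$, where $B^+ = B \cap \ker \epsilon$. Let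 $(\Omega^\bullet = \bigoplus_{k \ge 0} \Omega^k, \wedge, d)$ be an $A$-covariant differential calculus on $B$: a differential graded algebra with $\Omega^0 = B$, generated as an algebra by $B$ and $dB$, such that every $\Omega^k$ is an object of ${}^A_B\mathrm{Mod}_B$ (with $\Omega^0 = B$ carrying the coaction $\Delta|_B$), every multiplication map $\wedge : \Omega^k \otimes_B \Omega^l \to \Omega^{k+l}$ is a morphism of ${}^A_B\mathrm{Mod}_B$, and every $d : \Omega^k \to \Omega^{k+1}$ is left $A$-colinear. Suppose that every $\Omega^k$ is an object of ${}^A_B\mathrm{Mod}_0$. Then $(\Omega^\bullet, \wedge, d)$ is covariantly quasi-tame: there is a morphism $s : \Omega^2 \to \Omega^1 \otimes_B \Omega^1$ of ${}^A_B\mathrm{Mod}_B$ such that $\wedge \circ s = \mathrm{id}_{\Omega^2}$. -/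

import Mathlib

open scoped TensorProduct

universe u


noncomputable section

namespace QHS

/-! ### Balanced tensor products over a noncommutative algebra -/

section BTensor

variable (B : Type*) [Ring B] [Algebra ℂ B]
variable (M N : Type*) [AddCommGroup M] [Module ℂ M] [Module Bᵐᵒᵖ M]
  [AddCommGroup N] [Module ℂ N] [Module B N]

/-- The subspace of `M ⊗ N` spanned by the elements `m b ⊗ n - m ⊗ b n`. -/
def balanced : Submodule ℂ (M ⊗[ℂ] N) :=
  Submodule.span ℂ {t | ∃ (m : M) (b : B) (n : N),
    t = (MulOpposite.op b • m) ⊗ₜ[ℂ] n - m ⊗ₜ[ℂ] (b • n)}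

/-- The tensor product `M ⊗_B N` of a right `B`-module `M` and a left `B`-module `N`. -/
def BTensor : Type _ := (M ⊗[ℂ] N) ⧸ balanced B M N

instance : AddCommGroup (BTensor B M N) :=
  inferInstanceAs (AddCommGroup ((M ⊗[ℂ] N) ⧸ balanced B M N))

instance : Module ℂ (BTensor B M N) :=
  inferInstanceAs (Module ℂ ((M ⊗[ℂ] N) ⧸ balanced B M N))

namespace BTensor

/-- The quotient map `M ⊗ N → M ⊗_B N`. -/
def proj : M ⊗[ℂ] N →ₗ[ℂ] BTensor B M N := (balanced B M N).mkQ

/-- The pairing `(m, n) ↦ m ⊗_B n`. -/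
def mk : M →ₗ[ℂ] N →ₗ[ℂ] BTensor B M N :=
  (TensorProduct.mk ℂ M N).compr₂ (proj B M N)

variable {M N}

theorem mk_balanced (m : M) (b : B) (n : N) :
    mk B M N (MulOpposite.op b • m) n = mk B M N m (b • n) :=
  (Submodule.Quotient.eq (balanced B M N)).2 (Submodule.subset_span ⟨m, b, n, rfl⟩)

/-- A balanced `ℂ`-bilinear map `M × N → P` factors through `M ⊗_B N`. -/
def lift {P : Type*} [AddCommGroup P] [Module ℂ P] (f : M →ₗ[ℂ] N →ₗ[ℂ] P)
    (hf : ∀ (m : M) (b : B) (n : N), f (MulOpposite.op b • m) n = f m (b • n)) :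
    BTensor B M N →ₗ[ℂ] P :=
  (balanced B M N).liftQ (TensorProduct.lift f) <| by
    rw [balanced, Submodule.span_le]
    rintro _ ⟨m, b, n, rfl⟩
    simp [hf]

@[simp] theorem lift_mk {P : Type*} [AddCommGroup P] [Module ℂ P] (f : M →ₗ[ℂ] N →ₗ[ℂ] P)
    (hf : ∀ (m : M) (b : B) (n : N), f (MulOpposite.op b • m) n = f m (b • n))
    (m : M) (n : N) : lift B f hf (mk B M N m n) = f m n := by
  change (balanced B M N).liftQ (TensorProduct.lift f) _ (Submodule.Quotient.mk (m ⊗ₜ n)) = _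
  rw [Submodule.liftQ_apply, TensorProduct.lift.tmul]

variable {B} in
theorem induction_on {p : BTensor B M N → Prop} (t : BTensor B M N) (zero : p 0)
    (tmul : ∀ m n, p (mk B M N m n)) (add : ∀ s t, p s → p t → p (s + t)) : p t := by
  obtain ⟨x, rfl⟩ := (balanced B M N).mkQ_surjective t
  induction x with
  | zero => exact zero
  | tmul m n => exact tmul m n
  | add x y hx hy => exact add _ _ hx hy

variable {B} in
theorem hom_ext {P : Type*} [AddCommGroup P] [Module ℂ P] {f g : BTensor B M N →ₗ[ℂ] P}
    (h : ∀ m n, f (mk B M N m n) = g (mk B M N m n)) : f = g := by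
  ext t
  induction t using induction_on with
  | zero => simp
  | tmul m n => exact h m n
  | add s t hs ht => simp [hs, ht]

/-- For a left `B`-linear map `f : N → N'`, the map `id ⊗_B f : M ⊗_B N → M ⊗_B N'`. -/
def lTensor (M : Type*) [AddCommGroup M] [Module ℂ M] [Module Bᵐᵒᵖ M]
    {N' : Type*} [AddCommGroup N'] [Module ℂ N'] [Module B N']
    [IsScalarTower ℂ B N] [IsScalarTower ℂ B N'] (f : N →ₗ[B] N') :
    BTensor B M N →ₗ[ℂ] BTensor B M N' :=
  lift B ((mk B M N').compl₂ (f.restrictScalars ℂ)) fun m b n => by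
    simp [mk_balanced]

end BTensor

end BTensor

/-! ### Bimodule structure on the balanced tensor product -/

section Bimodule

variable (B : Type*) [Ring B] [Algebra ℂ B]
variable (M N : Type*)
  [AddCommGroup M] [Module ℂ M] [Module B M] [Module Bᵐᵒᵖ M]
  [IsScalarTower ℂ B M] [IsScalarTower ℂ Bᵐᵒᵖ M] [SMulCommClass B Bᵐᵒᵖ M]
  [AddCommGroup N] [Module ℂ N] [Module B N] [Module Bᵐᵒᵖ N]
  [IsScalarTower ℂ B N] [IsScalarTower ℂ Bᵐᵒᵖ N] [SMulCommClass B Bᵐᵒᵖ N]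

/-- The left action `(b, m) ↦ b m` as a `ℂ`-bilinear map. -/
def actL (M : Type*) [AddCommGroup M] [Module ℂ M] [Module B M] [IsScalarTower ℂ B M] :
    B →ₗ[ℂ] M →ₗ[ℂ] M :=
  (Algebra.lsmul ℂ ℂ M : B →ₐ[ℂ] Module.End ℂ M).toLinearMap

/-- The right action `(m, b) ↦ m b` as a `ℂ`-bilinear map. -/
def actR (M : Type*) [AddCommGroup M] [Module ℂ M] [Module Bᵐᵒᵖ M]
    [IsScalarTower ℂ Bᵐᵒᵖ M] : M →ₗ[ℂ] B →ₗ[ℂ] M :=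
  ((actL Bᵐᵒᵖ M).comp (MulOpposite.opLinearEquiv ℂ).toLinearMap).flip

@[simp] theorem actL_apply (M : Type*) [AddCommGroup M] [Module ℂ M] [Module B M]
    [IsScalarTower ℂ B M] (b : B) (m : M) : actL B M b m = b • m := rfl

@[simp] theorem actR_apply (M : Type*) [AddCommGroup M] [Module ℂ M] [Module Bᵐᵒᵖ M]
    [IsScalarTower ℂ Bᵐᵒᵖ M] (b : B) (m : M) : actR B M m b = MulOpposite.op b • m := rfl

namespace BTensor

/-- `b (m ⊗_B n) = b m ⊗_B n`. -/
instance : SMul B (BTensor B M N) where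
  smul b := lift B ((mk B M N).comp (actL B M b)) fun m c n => by
    simp [smul_comm b (MulOpposite.op c) m, mk_balanced]

/-- `(m ⊗_B n) b = m ⊗_B n b`. -/
instance : SMul Bᵐᵒᵖ (BTensor B M N) where
  smul b := lift B ((mk B M N).compl₂ (actL Bᵐᵒᵖ N b)) fun m c n => by
    simp [← smul_comm c b n, mk_balanced]

variable {M N}

@[simp] theorem smul_mk (b : B) (m : M) (n : N) :
    b • mk B M N m n = mk B M N (b • m) n := lift_mk B _ _ m n

@[simp] theorem op_smul_mk (b : Bᵐᵒᵖ) (m : M) (n : N) :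
    b • mk B M N m n = mk B M N m (b • n) := lift_mk B _ _ m n

theorem smul_add_l (b : B) (s t : BTensor B M N) : b • (s + t) = b • s + b • t :=
  LinearMap.map_add _ s t

theorem smul_zero_l (b : B) : b • (0 : BTensor B M N) = 0 := LinearMap.map_zero _

theorem smul_add_r (b : Bᵐᵒᵖ) (s t : BTensor B M N) : b • (s + t) = b • s + b • t :=
  LinearMap.map_add _ s t

theorem smul_zero_r (b : Bᵐᵒᵖ) : b • (0 : BTensor B M N) = 0 := LinearMap.map_zero _

instance : Module B (BTensor B M N) where
  smul_add := smul_add_l B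
  smul_zero := smul_zero_l B
  one_smul t := by
    induction t using induction_on with
    | zero => exact smul_zero_l B _
    | tmul m n => simp
    | add s t hs ht => rw [smul_add_l, hs, ht]
  mul_smul b c t := by
    induction t using induction_on with
    | zero => simp only [smul_zero_l]
    | tmul m n => simp [mul_smul]
    | add s t hs ht => simp only [smul_add_l, hs, ht]
  zero_smul t := by
    induction t using induction_on with
    | zero => exact smul_zero_l B _
    | tmul m n => simp
    | add s t hs ht => rw [smul_add_l, hs, ht, add_zero]
  add_smul b c t := by
    induction t using induction_on with
    | zero => simp only [smul_zero_l, add_zero]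
    | tmul m n => simp [add_smul]
    | add s t hs ht => simp only [smul_add_l, hs, ht]; abel

instance : Module Bᵐᵒᵖ (BTensor B M N) where
  smul_add := smul_add_r B
  smul_zero := smul_zero_r B
  one_smul t := by
    induction t using induction_on with
    | zero => exact smul_zero_r B _
    | tmul m n => simp
    | add s t hs ht => rw [smul_add_r, hs, ht]
  mul_smul b c t := by
    induction t using induction_on with
    | zero => simp only [smul_zero_r]
    | tmul m n => simp [mul_smul]
    | add s t hs ht => simp only [smul_add_r, hs, ht]
  zero_smul t := by
    induction t using induction_on with
    | zero => exact smul_zero_r B _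
    | tmul m n => simp
    | add s t hs ht => rw [smul_add_r, hs, ht, add_zero]
  add_smul b c t := by
    induction t using induction_on with
    | zero => simp only [smul_zero_r, add_zero]
    | tmul m n => simp [add_smul]
    | add s t hs ht => simp only [smul_add_r, hs, ht]; abel

instance : SMulCommClass B Bᵐᵒᵖ (BTensor B M N) where
  smul_comm b c t := by
    induction t using induction_on with
    | zero => simp only [smul_zero]
    | tmul m n => simp
    | add s t hs ht => simp only [smul_add, hs, ht]

instance : IsScalarTower ℂ B (BTensor B M N) where
  smul_assoc z b t := by
    induction t using induction_on with
    | zero => simp only [smul_zero]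
    | tmul m n => simp
    | add s t hs ht => simp only [smul_add, hs, ht]

instance : IsScalarTower ℂ Bᵐᵒᵖ (BTensor B M N) where
  smul_assoc z b t := by
    induction t using induction_on with
    | zero => simp only [smul_zero]
    | tmul m n => simp
    | add s t hs ht => simp only [smul_add, hs, ht]

end BTensor

end Bimodule

/-! ### Comodules, comodule algebras and relative Hopf modules -/

/-- A left comodule `V` over a coalgebra `A`. -/
class LeftComodule (A V : Type*) [AddCommGroup A] [Module ℂ A] [Coalgebra ℂ A]
    [AddCommGroup V] [Module ℂ V] where
  /-- The coaction `v ↦ v₍₋₁₎ ⊗ v₍₀₎`. -/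
  coact : V →ₗ[ℂ] A ⊗[ℂ] V
  coassoc : ∀ v, TensorProduct.assoc ℂ A A V
    ((Coalgebra.comul (R := ℂ) (A := A)).rTensor V (coact v)) = coact.lTensor A (coact v)
  counit : ∀ v, (Coalgebra.counit (R := ℂ) (A := A)).rTensor V (coact v) = 1 ⊗ₜ[ℂ] v

/-- The coaction on a left `A`-comodule `V`. -/
def coaction (A V : Type*) [AddCommGroup A] [Module ℂ A] [Coalgebra ℂ A]
    [AddCommGroup V] [Module ℂ V] [LeftComodule A V] : V →ₗ[ℂ] A ⊗[ℂ] V :=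
  LeftComodule.coact

/-- `f : V → W` is `A`-covariant: `δ (f v) = (id ⊗ f) (δ v)`. -/
def IsCovariantMap (A : Type*) {V W : Type*} [AddCommGroup A] [Module ℂ A] [Coalgebra ℂ A]
    [AddCommGroup V] [Module ℂ V] [LeftComodule A V]
    [AddCommGroup W] [Module ℂ W] [LeftComodule A W] (f : V →ₗ[ℂ] W) : Prop :=
  ∀ v, coaction A W (f v) = f.lTensor A (coaction A V v)

/-- For a bilinear map `μ : U × V → W`, the bilinear map
`(a ⊗ u, a' ⊗ v) ↦ a a' ⊗ μ u v`. -/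
def diagonal (A : Type*) [Ring A] [Algebra ℂ A] {U V W : Type*}
    [AddCommGroup U] [Module ℂ U] [AddCommGroup V] [Module ℂ V] [AddCommGroup W] [Module ℂ W]
    (μ : U →ₗ[ℂ] V →ₗ[ℂ] W) : A ⊗[ℂ] U →ₗ[ℂ] A ⊗[ℂ] V →ₗ[ℂ] A ⊗[ℂ] W :=
  TensorProduct.map₂ (LinearMap.mul ℂ A) μ

@[simp] theorem diagonal_tmul (A : Type*) [Ring A] [Algebra ℂ A] {U V W : Type*}
    [AddCommGroup U] [Module ℂ U] [AddCommGroup V] [Module ℂ V] [AddCommGroup W] [Module ℂ W]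
    (μ : U →ₗ[ℂ] V →ₗ[ℂ] W) (a a' : A) (x : U) (v : V) :
    diagonal A μ (a ⊗ₜ x) (a' ⊗ₜ v) = (a * a') ⊗ₜ μ x v := rfl

/-- A left `A`-comodule algebra `B`: the coaction is multiplicative and unital. -/
class LeftComoduleAlgebra (A B : Type*) [Ring A] [Bialgebra ℂ A] [Ring B] [Algebra ℂ B]
    extends LeftComodule A B where
  coact_one : coact 1 = 1 ⊗ₜ[ℂ] 1
  coact_mul : ∀ b c, coact (b * c) = coact b * coact c

/-- The objects of `^A_B Mod_B`: a `B`-bimodule `M` with a left `A`-coaction satisfying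
`δ (b m) = δ b δ m` and `δ (m b) = δ m δ b`. -/
class IsRelHopfBimodule (A B M : Type*) [Ring A] [Bialgebra ℂ A] [Ring B] [Algebra ℂ B]
    [LeftComoduleAlgebra A B] [AddCommGroup M] [Module ℂ M] [Module B M] [Module Bᵐᵒᵖ M]
    [IsScalarTower ℂ B M] [IsScalarTower ℂ Bᵐᵒᵖ M] [SMulCommClass B Bᵐᵒᵖ M]
    [LeftComodule A M] : Prop where
  coaction_smul : ∀ (b : B) (m : M),
    coaction A M (b • m) = diagonal A (actL B M) (coaction A B b) (coaction A M m)
  coaction_op_smul : ∀ (b : B) (m : M),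
    coaction A M (MulOpposite.op b • m) = diagonal A (actR B M) (coaction A M m) (coaction A B b)

/-- The morphisms of `^A_B Mod_B`: `B`-bilinear `A`-covariant maps. -/
structure IsRelHopfMorphism (A B : Type*) {M N : Type*} [Ring A] [Bialgebra ℂ A] [Ring B]
    [AddCommGroup M] [Module ℂ M] [Module B M] [Module Bᵐᵒᵖ M] [LeftComodule A M]
    [AddCommGroup N] [Module ℂ N] [Module B N] [Module Bᵐᵒᵖ N] [LeftComodule A N]
    (f : M →ₗ[ℂ] N) : Prop where
  map_smul : ∀ (b : B) (m : M), f (b • m) = b • f m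
  map_op_smul : ∀ (b : B) (m : M), f (MulOpposite.op b • m) = MulOpposite.op b • f m
  covariant : IsCovariantMap A f

/-! ### The diagonal coaction on `M ⊗_B N` -/

section TensorCoaction

/-- For bilinear `f : U × V → U'`, `g : U' × W → X`, `f' : V × W → W'`, `g' : U × W' → X` with
`g (f u v) w = g' u (f' v w)`, the diagonal extensions satisfy the same identity. -/
theorem diagonal_assoc (A : Type*) [Ring A] [Algebra ℂ A] {U V W U' W' X : Type*}
    [AddCommGroup U] [Module ℂ U] [AddCommGroup V] [Module ℂ V] [AddCommGroup W] [Module ℂ W]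
    [AddCommGroup U'] [Module ℂ U'] [AddCommGroup W'] [Module ℂ W']
    [AddCommGroup X] [Module ℂ X]
    (f : U →ₗ[ℂ] V →ₗ[ℂ] U') (g : U' →ₗ[ℂ] W →ₗ[ℂ] X)
    (f' : V →ₗ[ℂ] W →ₗ[ℂ] W') (g' : U →ₗ[ℂ] W' →ₗ[ℂ] X)
    (h : ∀ x v w, g (f x v) w = g' x (f' v w))
    (x : A ⊗[ℂ] U) (y : A ⊗[ℂ] V) (z : A ⊗[ℂ] W) :
    diagonal A g (diagonal A f x y) z = diagonal A g' x (diagonal A f' y z) := by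
  induction x with
  | zero => simp
  | add x x' hx hx' => simp [hx, hx']
  | tmul a x =>
    induction y with
    | zero => simp
    | add y y' hy hy' => simp [hy, hy']
    | tmul b y =>
      induction z with
      | zero => simp
      | add z z' hz hz' => simp only [map_add, hz, hz']
      | tmul c z => simp [h, mul_assoc]

variable (A B : Type*) [Ring A] [Bialgebra ℂ A] [Ring B] [Algebra ℂ B]
  [LeftComoduleAlgebra A B]
variable (M N : Type*)
  [AddCommGroup M] [Module ℂ M] [Module B M] [Module Bᵐᵒᵖ M]
  [IsScalarTower ℂ B M] [IsScalarTower ℂ Bᵐᵒᵖ M] [SMulCommClass B Bᵐᵒᵖ M]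
  [LeftComodule A M] [IsRelHopfBimodule A B M]
  [AddCommGroup N] [Module ℂ N] [Module B N] [Module Bᵐᵒᵖ N]
  [IsScalarTower ℂ B N] [IsScalarTower ℂ Bᵐᵒᵖ N] [SMulCommClass B Bᵐᵒᵖ N]
  [LeftComodule A N] [IsRelHopfBimodule A B N]

/-- `m ⊗_B n ↦ m₍₋₁₎ n₍₋₁₎ ⊗ (m₍₀₎ ⊗_B n₍₀₎)`. -/
def tensorCoaction : BTensor B M N →ₗ[ℂ] A ⊗[ℂ] BTensor B M N :=
  BTensor.lift B
    (((diagonal A (BTensor.mk B M N)).comp (coaction A M)).compl₂ (coaction A N))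
    fun m b n => by
      simp only [LinearMap.compl₂_apply, LinearMap.comp_apply,
        IsRelHopfBimodule.coaction_op_smul, IsRelHopfBimodule.coaction_smul]
      exact diagonal_assoc A _ _ _ _ (fun m b n => BTensor.mk_balanced B m b n) _ _ _

theorem tensorCoaction_mk (m : M) (n : N) :
    tensorCoaction A B M N (BTensor.mk B M N m n) =
      diagonal A (BTensor.mk B M N) (coaction A M m) (coaction A N n) :=
  BTensor.lift_mk B _ _ m n

variable {M N} in
theorem lTensor_tensorCoaction (x : A ⊗[ℂ] M) (y : A ⊗[ℂ] N) :
    (tensorCoaction A B M N).lTensor A (diagonal A (BTensor.mk B M N) x y) =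
      diagonal A (diagonal A (BTensor.mk B M N))
        ((coaction A M).lTensor A x) ((coaction A N).lTensor A y) := by
  induction x with
  | zero => simp
  | add x x' hx hx' => simp [hx, hx']
  | tmul a x =>
    induction y with
    | zero => simp
    | add y y' hy hy' => simp only [map_add, hy, hy']
    | tmul b y => simp [tensorCoaction_mk]

theorem assoc_comul_diagonal {U V W : Type*}
    [AddCommGroup U] [Module ℂ U] [AddCommGroup V] [Module ℂ V] [AddCommGroup W] [Module ℂ W]
    (μ : U →ₗ[ℂ] V →ₗ[ℂ] W) (x : A ⊗[ℂ] U) (y : A ⊗[ℂ] V) :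
    TensorProduct.assoc ℂ A A W
        ((Coalgebra.comul (R := ℂ) (A := A)).rTensor W (diagonal A μ x y)) =
      diagonal A (diagonal A μ)
        (TensorProduct.assoc ℂ A A U ((Coalgebra.comul (R := ℂ) (A := A)).rTensor U x))
        (TensorProduct.assoc ℂ A A V ((Coalgebra.comul (R := ℂ) (A := A)).rTensor V y)) := by
  induction x with
  | zero => simp
  | add x x' hx hx' => simp [hx, hx']
  | tmul a x =>
    induction y with
    | zero => simp
    | add y y' hy hy' => simp only [map_add, hy, hy']
    | tmul b y =>
      simp only [diagonal_tmul, LinearMap.rTensor_tmul, Bialgebra.comul_mul]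
      generalize Coalgebra.comul (R := ℂ) a = p
      generalize Coalgebra.comul (R := ℂ) b = q
      induction p with
      | zero => simp
      | add p p' hp hp' => simp only [add_mul, TensorProduct.add_tmul, map_add, hp, hp',
          LinearMap.add_apply]
      | tmul a a' =>
        induction q with
        | zero => simp
        | add q q' hq hq' => simp only [mul_add, TensorProduct.add_tmul, map_add, hq, hq']
        | tmul b b' => simp

theorem counit_diagonal {U V W : Type*}
    [AddCommGroup U] [Module ℂ U] [AddCommGroup V] [Module ℂ V] [AddCommGroup W] [Module ℂ W]
    (μ : U →ₗ[ℂ] V →ₗ[ℂ] W) (x : A ⊗[ℂ] U) (y : A ⊗[ℂ] V) :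
    (Coalgebra.counit (R := ℂ) (A := A)).rTensor W (diagonal A μ x y) =
      diagonal ℂ μ ((Coalgebra.counit (R := ℂ) (A := A)).rTensor U x)
        ((Coalgebra.counit (R := ℂ) (A := A)).rTensor V y) := by
  induction x with
  | zero => simp
  | add x x' hx hx' => simp [hx, hx']
  | tmul a x =>
    induction y with
    | zero => simp
    | add y y' hy hy' => simp only [map_add, hy, hy']
    | tmul b y => simp

instance : LeftComodule A (BTensor B M N) where
  coact := tensorCoaction A B M N
  coassoc t := by
    induction t using BTensor.induction_on with
    | zero => simp
    | add s t hs ht => simp only [map_add, hs, ht]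
    | tmul m n =>
      rw [tensorCoaction_mk, lTensor_tensorCoaction, assoc_comul_diagonal]
      congr 1
      · exact congrArg _ (LeftComodule.coassoc m)
      · exact LeftComodule.coassoc n
  counit t := by
    induction t using BTensor.induction_on with
    | zero => simp
    | add s t hs ht => simp only [map_add, hs, ht, TensorProduct.tmul_add]
    | tmul m n =>
      rw [tensorCoaction_mk, counit_diagonal]
      refine (congrArg₂ (fun x y => diagonal ℂ (BTensor.mk B M N) x y)
        (LeftComodule.counit m) (LeftComodule.counit n)).trans ?_
      simp

instance : IsRelHopfBimodule A B (BTensor B M N) where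
  coaction_smul b t := by
    induction t using BTensor.induction_on with
    | zero => simp
    | add s t hs ht => simp only [smul_add, map_add, hs, ht]
    | tmul m n =>
      change tensorCoaction A B M N _ = diagonal A _ _ (tensorCoaction A B M N _)
      rw [BTensor.smul_mk, tensorCoaction_mk, tensorCoaction_mk,
        IsRelHopfBimodule.coaction_smul]
      exact diagonal_assoc A _ _ _ _ (fun b m n => (BTensor.smul_mk B b m n).symm) _ _ _
  coaction_op_smul b t := by
    induction t using BTensor.induction_on with
    | zero => simp
    | add s t hs ht => simp only [smul_add, map_add, hs, ht, LinearMap.add_apply]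
    | tmul m n =>
      change tensorCoaction A B M N _ = diagonal A _ (tensorCoaction A B M N _) _
      rw [BTensor.op_smul_mk, tensorCoaction_mk, tensorCoaction_mk,
        IsRelHopfBimodule.coaction_op_smul]
      exact (diagonal_assoc A _ _ _ _
        (fun m n b => BTensor.op_smul_mk B (MulOpposite.op b) m n) _ _ _).symm

end TensorCoaction

/-! ### Differential calculi -/

/-- A differential calculus on `B`: a differential graded algebra `Ω = ⨁ Ω^k` with `Ω^0 = B`
(through `ofB`), generated as an algebra by `B` and `d B`. -/
structure DifferentialCalculus (B : Type*) [Ring B] [Algebra ℂ B]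
    {Ω : Type*} [Ring Ω] [Algebra ℂ Ω] (deg : ℕ → Submodule ℂ Ω) [GradedAlgebra deg] where
  ofB : B →ₐ[ℂ] Ω
  ofB_injective : Function.Injective ofB
  range_ofB : LinearMap.range ofB.toLinearMap = deg 0
  d : Ω →ₗ[ℂ] Ω
  d_mem : ∀ k, ∀ ω ∈ deg k, d ω ∈ deg (k + 1)
  d_d : ∀ ω, d (d ω) = 0
  leibniz : ∀ k, ∀ ω ∈ deg k, ∀ η, d (ω * η) = d ω * η + (-1) ^ k * (ω * d η)
  adjoin_eq_top : Algebra.adjoin ℂ (Set.range ofB ∪ Set.range fun b => d (ofB b)) = ⊤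

namespace DifferentialCalculus

variable {B : Type*} [Ring B] [Algebra ℂ B] {Ω : Type*} [Ring Ω] [Algebra ℂ Ω]
  {deg : ℕ → Submodule ℂ Ω} [GradedAlgebra deg] (C : DifferentialCalculus B deg)

/-- The space `Ω^k` of `k`-forms. -/
def Form (_C : DifferentialCalculus B deg) (k : ℕ) : Type _ := ↥(deg k)

variable (k l : ℕ)

instance : AddCommGroup (C.Form k) := inferInstanceAs (AddCommGroup ↥(deg k))

instance : Module ℂ (C.Form k) := inferInstanceAs (Module ℂ ↥(deg k))

/-- The inclusion `Ω^k ⊆ Ω`. -/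
def incl : C.Form k →ₗ[ℂ] Ω := (deg k).subtype

theorem incl_injective : Function.Injective (C.incl k) := Subtype.coe_injective

theorem ofB_mem (b : B) : C.ofB b ∈ deg 0 := by
  rw [← C.range_ofB]
  exact ⟨b, rfl⟩

instance : SMul B (C.Form k) where
  smul b ω := ⟨C.ofB b * C.incl k ω, by
    simpa using SetLike.mul_mem_graded (C.ofB_mem b) (show C.incl k ω ∈ deg k from ω.2)⟩

instance : SMul Bᵐᵒᵖ (C.Form k) where
  smul b ω := ⟨C.incl k ω * C.ofB b.unop, by
    simpa using SetLike.mul_mem_graded (show C.incl k ω ∈ deg k from ω.2) (C.ofB_mem b.unop)⟩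

@[simp] theorem incl_smul (b : B) (ω : C.Form k) :
    C.incl k (b • ω) = C.ofB b * C.incl k ω := rfl

@[simp] theorem incl_op_smul (b : Bᵐᵒᵖ) (ω : C.Form k) :
    C.incl k (b • ω) = C.incl k ω * C.ofB b.unop := rfl

instance : Module B (C.Form k) where
  one_smul ω := C.incl_injective k (by simp)
  mul_smul b c ω := C.incl_injective k (by simp [mul_assoc])
  smul_zero b := C.incl_injective k (by simp)
  smul_add b ω η := C.incl_injective k (by simp [mul_add])
  add_smul b c ω := C.incl_injective k (by simp [add_mul])
  zero_smul ω := C.incl_injective k (by simp)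

instance : Module Bᵐᵒᵖ (C.Form k) where
  one_smul ω := C.incl_injective k (by simp)
  mul_smul b c ω := C.incl_injective k (by simp [mul_assoc])
  smul_zero b := C.incl_injective k (by simp)
  smul_add b ω η := C.incl_injective k (by simp [add_mul])
  add_smul b c ω := C.incl_injective k (by simp [mul_add])
  zero_smul ω := C.incl_injective k (by simp)

instance : IsScalarTower ℂ B (C.Form k) where
  smul_assoc z b ω := C.incl_injective k (by simp)

instance : IsScalarTower ℂ Bᵐᵒᵖ (C.Form k) where
  smul_assoc z b ω := C.incl_injective k (by simp)

instance : SMulCommClass B Bᵐᵒᵖ (C.Form k) where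
  smul_comm b c ω := C.incl_injective k (by simp [mul_assoc])

/-- The multiplication `Ω^k × Ω^l → Ω^(k+l)`. -/
def mulForm : C.Form k →ₗ[ℂ] C.Form l →ₗ[ℂ] C.Form (k + l) :=
  LinearMap.mk₂ ℂ
    (fun ω η => ⟨C.incl k ω * C.incl l η, SetLike.mul_mem_graded ω.2 η.2⟩)
    (fun _ _ _ => Subtype.ext (add_mul _ _ _))
    (fun _ _ _ => Subtype.ext (smul_mul_assoc _ _ _))
    (fun _ _ _ => Subtype.ext (mul_add _ _ _))
    (fun _ _ _ => Subtype.ext (mul_smul_comm _ _ _))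

@[simp] theorem incl_mulForm (ω : C.Form k) (η : C.Form l) :
    C.incl (k + l) (C.mulForm k l ω η) = C.incl k ω * C.incl l η := rfl

/-- The map `∧ : Ω^k ⊗_B Ω^l → Ω^(k+l)`. -/
def wedge : BTensor B (C.Form k) (C.Form l) →ₗ[ℂ] C.Form (k + l) :=
  BTensor.lift B (C.mulForm k l) fun ω b η =>
    C.incl_injective (k + l) (by simp [mul_assoc])

/-- The differential `d : Ω^k → Ω^(k+1)`. -/
def dForm : C.Form k →ₗ[ℂ] C.Form (k + 1) :=
  (C.d.comp (deg k).subtype).codRestrict (deg (k + 1)) fun ω => C.d_mem k ω ω.2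

/-- The identification `B → Ω^0`. -/
def ofBForm : B →ₗ[ℂ] C.Form 0 :=
  C.ofB.toLinearMap.codRestrict (deg 0) C.ofB_mem

section Covariant

variable (A : Type*) [Ring A] [Bialgebra ℂ A] [LeftComoduleAlgebra A B]
  [∀ k, LeftComodule A (C.Form k)] [∀ k, IsRelHopfBimodule A B (C.Form k)]

/-- Covariance of a calculus whose spaces of forms are objects of `^A_B Mod_B`: `Ω^0` is `B` as a
comodule, `∧` is a morphism of `^A_B Mod_B`, and `d` is `A`-covariant. -/
structure IsCovariant : Prop where
  ofB_covariant : IsCovariantMap A C.ofBForm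
  wedge_morphism : ∀ k l, IsRelHopfMorphism A B (C.wedge k l)
  d_covariant : ∀ k, IsCovariantMap A (C.dForm k)

/-- There is a morphism `s : Ω^2 → Ω^1 ⊗_B Ω^1` of `^A_B Mod_B` with `∧ ∘ s = id`. -/
def IsCovariantlyQuasiTame : Prop :=
  ∃ s : C.Form 2 →ₗ[ℂ] BTensor B (C.Form 1) (C.Form 1),
    IsRelHopfMorphism A B s ∧ C.wedge 1 1 ∘ₗ s = LinearMap.id

end Covariant

end DifferentialCalculus

/-! ### Quantum homogeneous spaces -/

section Homogeneous

variable {A H : Type*} [Ring A] [HopfAlgebra ℂ A] [Ring H] [HopfAlgebra ℂ H]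

/-- The right `H`-coaction `(id ⊗ π) ∘ Δ` on `A`. -/
def rightCoaction (π : A →ₐc[ℂ] H) : A →ₐ[ℂ] A ⊗[ℂ] H :=
  (Algebra.TensorProduct.map (AlgHom.id ℂ A) (π : A →ₐ[ℂ] H)).comp (Bialgebra.comulAlgHom ℂ A)

/-- The coinvariant subalgebra `A^co(H) = {a | (id ⊗ π) (Δ a) = a ⊗ 1}`. -/
def coinvariants (π : A →ₐc[ℂ] H) : Subalgebra ℂ A :=
  AlgHom.equalizer (rightCoaction π) Algebra.TensorProduct.includeLeft

theorem mem_coinvariants (π : A →ₐc[ℂ] H) (a : A) :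
    a ∈ coinvariants π ↔ (π : A →ₗ[ℂ] H).lTensor A (Coalgebra.comul (R := ℂ) a) = a ⊗ₜ 1 :=
  Iff.rfl

/-- The map `A ⊗ A^co(H) → A ⊗ A`. -/
def coinvIncl (π : A →ₐc[ℂ] H) : A ⊗[ℂ] coinvariants π →ₗ[ℂ] A ⊗[ℂ] A :=
  (coinvariants π).val.toLinearMap.lTensor A

theorem coinvIncl_injective (π : A →ₐc[ℂ] H) : Function.Injective (coinvIncl π) :=
  Module.Flat.lTensor_preserves_injective_linearMap _ Subtype.coe_injective

theorem assoc_rTensor_lTensor (A : Type*) [AddCommGroup A] [Module ℂ A] {X Y : Type*}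
    [AddCommGroup X] [Module ℂ X] [AddCommGroup Y] [Module ℂ Y]
    (f : X →ₗ[ℂ] Y) (g : A →ₗ[ℂ] A ⊗[ℂ] A) (x : A ⊗[ℂ] X) :
    TensorProduct.assoc ℂ A A Y (g.rTensor Y (f.lTensor A x)) =
      (f.lTensor A).lTensor A (TensorProduct.assoc ℂ A A X (g.rTensor X x)) := by
  induction x with
  | zero => simp
  | add x y hx hy => simp only [map_add, hx, hy]
  | tmul a x =>
    simp only [LinearMap.lTensor_tmul, LinearMap.rTensor_tmul]
    generalize g a = p
    induction p with
    | zero => simp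
    | add p q hp hq => simp only [TensorProduct.add_tmul, map_add, hp, hq]
    | tmul a a' => simp

/-- The coproduct of `A` maps the coinvariants `B` into `A ⊗ B`. -/
theorem comul_mem_range (π : A →ₐc[ℂ] H) (b : coinvariants π) :
    Coalgebra.comul (R := ℂ) (b : A) ∈ LinearMap.range (coinvIncl π) := by
  let φ : A →ₗ[ℂ] A ⊗[ℂ] H :=
    (π : A →ₗ[ℂ] H).lTensor A ∘ₗ Coalgebra.comul - (TensorProduct.mk ℂ A H).flip 1
  have hex : Function.Exact (coinvariants π).val.toLinearMap φ := by
    intro a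
    rw [LinearMap.sub_apply, sub_eq_zero]
    exact ⟨fun h => ⟨⟨a, h⟩, rfl⟩, fun ⟨c, hc⟩ => hc ▸ c.2⟩
  refine (Module.Flat.lTensor_exact A hex _).1 ?_
  have hb : (π : A →ₗ[ℂ] H).lTensor A (Coalgebra.comul (R := ℂ) (b : A)) = (b : A) ⊗ₜ 1 := b.2
  have h1 := assoc_rTensor_lTensor A (π : A →ₗ[ℂ] H) Coalgebra.comul
    (Coalgebra.comul (R := ℂ) (b : A))
  rw [hb, LinearMap.rTensor_tmul, Coalgebra.coassoc_apply] at h1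
  rw [LinearMap.lTensor_sub, LinearMap.sub_apply, sub_eq_zero, LinearMap.lTensor_comp,
    LinearMap.comp_apply, ← h1]
  generalize Coalgebra.comul (R := ℂ) (b : A) = x
  induction x with
  | zero => simp
  | add x y hx hy => simp only [TensorProduct.add_tmul, map_add, hx, hy]
  | tmul a a' => simp

/-- The coaction `Δ|_B : B → A ⊗ B`. -/
def coinvCoact (π : A →ₐc[ℂ] H) : coinvariants π →ₗ[ℂ] A ⊗[ℂ] coinvariants π :=
  (LinearEquiv.ofInjective (coinvIncl π) (coinvIncl_injective π)).symm.toLinearMap.comp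
    ((Coalgebra.comul.comp (coinvariants π).val.toLinearMap).codRestrict
      (LinearMap.range (coinvIncl π)) (comul_mem_range π))

theorem coinvIncl_coinvCoact (π : A →ₐc[ℂ] H) (b : coinvariants π) :
    coinvIncl π (coinvCoact π b) = Coalgebra.comul (R := ℂ) (b : A) :=
  congrArg Subtype.val (LinearEquiv.apply_symm_apply
    (LinearEquiv.ofInjective (coinvIncl π) (coinvIncl_injective π)) _)

/-- `B = A^co(H)` is a left `A`-comodule algebra with the restriction of `Δ`. -/
instance (π : A →ₐc[ℂ] H) : LeftComoduleAlgebra A (coinvariants π) where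
  coact := coinvCoact π
  coassoc b := by
    have hinj : Function.Injective ((coinvIncl π).lTensor A) :=
      Module.Flat.lTensor_preserves_injective_linearMap _ (coinvIncl_injective π)
    apply hinj
    have hc : coinvIncl π ∘ₗ coinvCoact π =
        Coalgebra.comul ∘ₗ (coinvariants π).val.toLinearMap :=
      LinearMap.ext (coinvIncl_coinvCoact π)
    have hr : (coinvIncl π).lTensor A ((coinvCoact π).lTensor A (coinvCoact π b)) =
        Coalgebra.comul.lTensor A (coinvIncl π (coinvCoact π b)) := by
      rw [← LinearMap.comp_apply, ← LinearMap.lTensor_comp, hc, LinearMap.lTensor_comp,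
        LinearMap.comp_apply]
      rfl
    rw [hr, coinvIncl_coinvCoact, coinvIncl, ← assoc_rTensor_lTensor]
    change TensorProduct.assoc ℂ A A A
      (Coalgebra.comul.rTensor A (coinvIncl π (coinvCoact π b))) = _
    rw [coinvIncl_coinvCoact, Coalgebra.coassoc_apply]
  counit b := by
    have hinj : Function.Injective ((coinvariants π).val.toLinearMap.lTensor ℂ) :=
      Module.Flat.lTensor_preserves_injective_linearMap _ Subtype.coe_injective
    apply hinj
    rw [← LinearMap.comp_apply, LinearMap.lTensor_comp_rTensor, ← LinearMap.rTensor_comp_lTensor,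
      LinearMap.comp_apply]
    change Coalgebra.counit.rTensor A (coinvIncl π (coinvCoact π b)) = _
    rw [coinvIncl_coinvCoact, Coalgebra.rTensor_counit_comul]
    rfl
  coact_one := coinvIncl_injective π <| by
    rw [coinvIncl_coinvCoact]
    simp [coinvIncl, Algebra.TensorProduct.one_def]
  coact_mul b c := coinvIncl_injective π <| by
    have h : ∀ x y, coinvIncl π (x * y) = coinvIncl π x * coinvIncl π y :=
      map_mul (Algebra.TensorProduct.map (AlgHom.id ℂ A) (coinvariants π).val)
    rw [h]
    simp only [coinvIncl_coinvCoact]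
    simp

/-- The right multiplication action of `A^co(H)` on `A`. -/
instance (π : A →ₐc[ℂ] H) : Module (coinvariants π)ᵐᵒᵖ A :=
  Module.compHom A ((coinvariants π).val.toRingHom.op)

end Homogeneous

/-- `P` is faithfully flat as a right `B`-module: a sequence of left `B`-modules is exact if and
only if it becomes exact after applying `P ⊗_B -`. -/
def IsRightFaithfullyFlat (B P : Type u) [Ring B] [Algebra ℂ B]
    [AddCommGroup P] [Module ℂ P] [Module Bᵐᵒᵖ P] : Prop :=
  ∀ (L M N : Type u) [AddCommGroup L] [Module ℂ L] [Module B L] [IsScalarTower ℂ B L]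
    [AddCommGroup M] [Module ℂ M] [Module B M] [IsScalarTower ℂ B M]
    [AddCommGroup N] [Module ℂ N] [Module B N] [IsScalarTower ℂ B N]
    (f : L →ₗ[B] M) (g : M →ₗ[B] N),
    Function.Exact f g ↔
      Function.Exact (BTensor.lTensor B P f) (BTensor.lTensor B P g)

/-- `B = A^co(H)` is a quantum homogeneous space of `A`, where `π : A → H` is a surjective
homomorphism of Hopf algebras. -/
structure IsQuantumHomogeneousSpace {A H : Type u} [Ring A] [HopfAlgebra ℂ A]
    [Ring H] [HopfAlgebra ℂ H] (π : A →ₐc[ℂ] H) : Prop where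
  surjective : Function.Surjective π
  faithfullyFlat : IsRightFaithfullyFlat (coinvariants π) A

/-- `M` lies in `^A_B Mod_0`: it is finitely generated as a left `B`-module and `M B⁺ = B⁺ M`,
where `B⁺ = B ∩ ker ε`. -/
structure IsModZero {A H : Type*} [Ring A] [HopfAlgebra ℂ A] [Ring H] [HopfAlgebra ℂ H]
    (π : A →ₐc[ℂ] H) (M : Type*) [AddCommGroup M] [Module ℂ M]
    [Module (coinvariants π) M] [Module (coinvariants π)ᵐᵒᵖ M] : Prop where
  finite : Module.Finite (coinvariants π) M
  comm : Submodule.span ℂ {x : M | ∃ (m : M) (b : coinvariants π),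
        Coalgebra.counit (R := ℂ) (b : A) = 0 ∧ x = MulOpposite.op b • m} =
      Submodule.span ℂ {x : M | ∃ (b : coinvariants π) (m : M),
        Coalgebra.counit (R := ℂ) (b : A) = 0 ∧ x = b • m}

/-! ### Cosemisimple coalgebras -/

/-- `D ⊆ H` is a subcoalgebra: `Δ D ⊆ D ⊗ D`. -/
def IsSubcoalgebra {H : Type*} [AddCommGroup H] [Module ℂ H] [Coalgebra ℂ H]
    (D : Submodule ℂ H) : Prop :=
  ∀ x ∈ D, Coalgebra.comul (R := ℂ) x ∈ LinearMap.range (TensorProduct.map D.subtype D.subtype)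

/-- A nonzero subcoalgebra without proper nonzero subcoalgebras. -/
structure IsSimpleSubcoalgebra {H : Type*} [AddCommGroup H] [Module ℂ H] [Coalgebra ℂ H]
    (D : Submodule ℂ H) : Prop where
  isSubcoalgebra : IsSubcoalgebra D
  ne_bot : D ≠ ⊥
  eq_bot_or_eq : ∀ E : Submodule ℂ H, IsSubcoalgebra E → E ≤ D → E = ⊥ ∨ E = D

/-- `H` is cosemisimple: it is a direct sum of simple subcoalgebras. -/
def IsCosemisimple (H : Type u) [AddCommGroup H] [Module ℂ H] [Coalgebra ℂ H] : Prop :=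
  ∃ (ι : Type u) (D : ι → Submodule ℂ H),
    (∀ i, IsSimpleSubcoalgebra (D i)) ∧ iSupIndep D ∧ ⨆ i, D i = ⊤

end QHS

end

open QHS

/-!
Cosemisimplicity of `H` gives a normalized left invariant functional `h` on `H`. Convolving with
`h ∘ π` turns it into a conditional expectation `E : A → B`: a unital, `B`-bilinear and
`A`-colinear map. For an object `M` of `^A_B Mod_B` the map `a ⊗ m ↦ E(a S(m₍₋₁₎)) m₍₀₎` is then a
`B`-linear, `A`-colinear retraction of the coaction `M → A ⊗ M`, and it descends to `A ⊗ M / B⁺M`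
because `S(b₍₁₎) b₍₂₎ = ε(b)`. Hence any linear map `T : N / B⁺N → M` induces a `B`-linear,
`A`-colinear map `n ↦ E(n₍₋₁₎ S(T[n₍₀₎]₍₋₁₎)) T[n₍₀₎]₍₀₎`; the inclusions `MB⁺ ⊆ B⁺M` and
`NB⁺ ⊆ B⁺N` make it right `B`-linear as well. If `T` is a right inverse of the surjection
`M → N → N / B⁺N` coming from a surjective morphism `f : M → N`, then the induced map is a section
of `f`. This applies to `∧ : Ω^1 ⊗_B Ω^1 → Ω^2`, which is surjective because `Ω` is generated in
degrees `0` and `1`.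
-/

noncomputable section

namespace QHS

section Haar

section Coalgebra

variable {H : Type*} [AddCommGroup H] [Module ℂ H] [Coalgebra ℂ H]

theorem eq_counit_smul_of_comul_eq_tmul {x g : H} (h : Coalgebra.comul (R := ℂ) x = x ⊗ₜ g) :
    x = Coalgebra.counit (R := ℂ) x • g := by
  simpa [h, eq_comm] using
    congrArg (TensorProduct.lid ℂ H) (Coalgebra.rTensor_counit_comul (R := ℂ) x)

theorem isSubcoalgebra_span_singleton {g : H} (hg : IsGroupLikeElem ℂ g) :
    IsSubcoalgebra (Submodule.span ℂ {g}) := by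
  intro x hx
  obtain ⟨c, rfl⟩ := Submodule.mem_span_singleton.1 hx
  let g' : Submodule.span ℂ {g} := ⟨g, Submodule.mem_span_singleton_self g⟩
  exact ⟨c • g' ⊗ₜ g', by simp [g', hg.comul_eq_tmul_self]⟩

theorem IsSimpleSubcoalgebra.eq_span_singleton {D : Submodule ℂ H} (hD : IsSimpleSubcoalgebra D)
    {g : H} (hg : IsGroupLikeElem ℂ g) (hgD : g ∈ D) : D = Submodule.span ℂ {g} :=
  ((hD.eq_bot_or_eq _ (isSubcoalgebra_span_singleton hg)
    ((Submodule.span_singleton_le_iff_mem g D).2 hgD)).resolve_left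
      (Submodule.span_singleton_eq_bot.not.2 hg.ne_zero)).symm

theorem IsSubcoalgebra.map_comul_congr {D : Submodule ℂ H} (hD : IsSubcoalgebra D)
    {f f' g g' : H →ₗ[ℂ] H} (hf : Set.EqOn f f' D) (hg : Set.EqOn g g' D) {x : H} (hx : x ∈ D) :
    TensorProduct.map f g (Coalgebra.comul x) = TensorProduct.map f' g' (Coalgebra.comul x) := by
  obtain ⟨t, ht⟩ := hD x hx
  have hf' : f ∘ₗ D.subtype = f' ∘ₗ D.subtype := LinearMap.ext fun y => hf y.2
  have hg' : g ∘ₗ D.subtype = g' ∘ₗ D.subtype := LinearMap.ext fun y => hg y.2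
  rw [← ht, TensorProduct.map_map, TensorProduct.map_map, hf', hg']

end Coalgebra

section Decomposition

variable {H ι : Type*} [AddCommGroup H] [Module ℂ H] [DecidableEq ι]
  (D : ι → Submodule ℂ H) [DirectSum.Decomposition D]

/-- The projection of a direct sum `H = ⨁ i, D i` onto the summand `D i`, as an endomorphism of
`H`. -/
def summandProj (i : ι) : H →ₗ[ℂ] H :=
  (D i).subtype ∘ₗ DirectSum.component ℂ ι (fun i => D i) i ∘ₗ DirectSum.decomposeLinearEquiv D

theorem summandProj_mem (i : ι) (x : H) : summandProj D i x ∈ D i :=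
  (DirectSum.decompose D x i).2

theorem summandProj_eqOn_id (i : ι) : Set.EqOn (summandProj D i) (LinearMap.id (R := ℂ)) (D i) :=
  fun _ hx => DirectSum.decompose_of_mem_same D hx

theorem summandProj_eqOn_zero {i j : ι} (h : j ≠ i) :
    Set.EqOn (summandProj D i) (0 : H →ₗ[ℂ] H) (D j) :=
  fun _ hx => DirectSum.decompose_of_mem_ne D hx h

theorem exists_summandProj_ne_zero {x : H} (hx : x ≠ 0) : ∃ i, summandProj D i x ≠ 0 := by
  contrapose! hx
  apply (DirectSum.decompose D).injective
  ext i
  rw [DirectSum.decompose_zero]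
  exact hx i

variable [Coalgebra ℂ H] {D} (hD : ∀ i, IsSubcoalgebra (D i)) (i : ι)
include hD

theorem rTensor_summandProj_comul (x : H) :
    (summandProj D i).rTensor H (Coalgebra.comul x) = Coalgebra.comul (summandProj D i x) := by
  induction x using DirectSum.Decomposition.inductionOn D with
  | zero => simp
  | add x y hx hy => simp only [map_add, hx, hy]
  | @homogeneous j x =>
    rcases eq_or_ne j i with rfl | hji
    · rw [summandProj_eqOn_id D j x.2, LinearMap.rTensor,
        (hD j).map_comul_congr (summandProj_eqOn_id D j) (Set.eqOn_refl _ _) x.2]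
      simp
    · rw [summandProj_eqOn_zero D hji x.2, LinearMap.rTensor,
        (hD j).map_comul_congr (summandProj_eqOn_zero D hji) (Set.eqOn_refl _ _) x.2]
      simp

theorem lTensor_summandProj_comul (x : H) :
    (summandProj D i).lTensor H (Coalgebra.comul x) = Coalgebra.comul (summandProj D i x) := by
  induction x using DirectSum.Decomposition.inductionOn D with
  | zero => simp
  | add x y hx hy => simp only [map_add, hx, hy]
  | @homogeneous j x =>
    rcases eq_or_ne j i with rfl | hji
    · rw [summandProj_eqOn_id D j x.2, LinearMap.lTensor,
        (hD j).map_comul_congr (Set.eqOn_refl _ _) (summandProj_eqOn_id D j) x.2]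
      simp
    · rw [summandProj_eqOn_zero D hji x.2, LinearMap.lTensor,
        (hD j).map_comul_congr (Set.eqOn_refl _ _) (summandProj_eqOn_zero D hji) x.2]
      simp

theorem mem_of_summandProj_ne_zero {g : H} (hg : IsGroupLikeElem ℂ g)
    (hgi : summandProj D i g ≠ 0) : g ∈ D i := by
  have hproj : summandProj D i g = Coalgebra.counit (R := ℂ) (summandProj D i g) • g :=
    eq_counit_smul_of_comul_eq_tmul <| by
      rw [← rTensor_summandProj_comul hD, hg.comul_eq_tmul_self, LinearMap.rTensor_tmul]
  have hmem := summandProj_mem D i g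
  rw [hproj] at hmem hgi
  exact ((D i).smul_mem_iff (left_ne_zero_of_smul hgi)).1 hmem

end Decomposition

theorem IsCosemisimple.exists_invariant_functional {H : Type*} [AddCommGroup H] [Module ℂ H]
    [Coalgebra ℂ H] (hH : IsCosemisimple H) {g : H} (hg : IsGroupLikeElem ℂ g) :
    ∃ h : H →ₗ[ℂ] ℂ, h g = 1 ∧ ∀ x, h.lTensor H (Coalgebra.comul x) = g ⊗ₜ h x := by
  classical
  obtain ⟨ι, D, hD, hind, htop⟩ := hH
  let := (DirectSum.isInternal_submodule_of_iSupIndep_of_iSup_eq_top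
    hind htop).chooseDecomposition
  have hsub i : IsSubcoalgebra (D i) := (hD i).isSubcoalgebra
  obtain ⟨i, hi⟩ := exists_summandProj_ne_zero D hg.ne_zero
  have hgD : g ∈ D i := mem_of_summandProj_ne_zero hsub i hg hi
  refine ⟨Coalgebra.counit ∘ₗ summandProj D i, ?_, fun x => ?_⟩
  · rw [LinearMap.comp_apply, summandProj_eqOn_id D i hgD, LinearMap.id_apply,
      hg.counit_eq_one]
  · have hx : summandProj D i x ∈ Submodule.span ℂ {g} :=
      (hD i).eq_span_singleton hg hgD ▸ summandProj_mem D i x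
    obtain ⟨c, hc⟩ := Submodule.mem_span_singleton.1 hx
    rw [LinearMap.lTensor_comp, LinearMap.comp_apply, lTensor_summandProj_comul hsub,
      Coalgebra.lTensor_counit_comul, LinearMap.comp_apply, ← hc, map_smul, hg.counit_eq_one,
      smul_eq_mul, mul_one, TensorProduct.smul_tmul, smul_eq_mul, mul_one]

/-- `h` is a normalized left invariant functional, `x₍₁₎ h(x₍₂₎) = h(x) 1`: the Haar functional
of a cosemisimple bialgebra. -/
structure IsHaarFunctional {H : Type*} [Ring H] [Bialgebra ℂ H] (h : H →ₗ[ℂ] ℂ) : Prop where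
  map_one : h 1 = 1
  lTensor_comul : ∀ x, h.lTensor H (Coalgebra.comul x) = 1 ⊗ₜ h x

theorem IsCosemisimple.exists_isHaarFunctional {H : Type*} [Ring H] [Bialgebra ℂ H]
    (hH : IsCosemisimple H) : ∃ h : H →ₗ[ℂ] ℂ, IsHaarFunctional h :=
  let ⟨h, h_one, h_comul⟩ := hH.exists_invariant_functional IsGroupLikeElem.one
  ⟨h, h_one, h_comul⟩

end Haar

section ConditionalExpectation

/-- A coalgebra as a left comodule over itself, coacting through its comultiplication. -/
instance LeftComodule.self (A : Type*) [AddCommGroup A] [Module ℂ A] [Coalgebra ℂ A] :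
    LeftComodule A A where
  coact := Coalgebra.comul
  coassoc := Coalgebra.coassoc_apply
  counit := Coalgebra.rTensor_counit_comul

@[simp] theorem coaction_self (A : Type*) [AddCommGroup A] [Module ℂ A] [Coalgebra ℂ A] :
    coaction A A = Coalgebra.comul := rfl

/-- `E` is a conditional expectation of `A` onto the comodule algebra `B`, included in `A` by `ι`:
a unital, `B`-bilinear and `A`-covariant linear map. -/
structure IsConditionalExpectation {A B : Type*} [Ring A] [Bialgebra ℂ A] [Ring B] [Algebra ℂ B]
    [LeftComoduleAlgebra A B] (ι : B →ₐ[ℂ] A) (E : A →ₗ[ℂ] B) : Prop where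
  map_one : E 1 = 1
  map_mul_left : ∀ b a, E (ι b * a) = b * E a
  map_mul_right : ∀ a b, E (a * ι b) = E a * b
  covariant : IsCovariantMap A E

section Average

variable {A : Type*} [AddCommGroup A] [Module ℂ A] [Coalgebra ℂ A]

/-- The right convolution `a ↦ a₍₁₎ φ(a₍₂₎)` by a functional `φ`. -/
def rightConvolution (φ : A →ₗ[ℂ] ℂ) : A →ₗ[ℂ] A :=
  TensorProduct.rid ℂ A ∘ₗ φ.lTensor A ∘ₗ Coalgebra.comul

theorem rightConvolution_covariant (φ : A →ₗ[ℂ] ℂ) : IsCovariantMap A (rightConvolution φ) := by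
  intro a
  have h (t : A ⊗[ℂ] A) : Coalgebra.comul (TensorProduct.rid ℂ A (φ.lTensor A t)) =
      (TensorProduct.rid ℂ A ∘ₗ φ.lTensor A).lTensor A
        (TensorProduct.assoc ℂ A A A (Coalgebra.comul.rTensor A t)) := by
    induction t with
    | zero => simp
    | add s t hs ht => simp only [map_add, hs, ht]
    | tmul x y =>
      simp only [LinearMap.lTensor_tmul, TensorProduct.rid_tmul, map_smul, LinearMap.rTensor_tmul]
      induction Coalgebra.comul (R := ℂ) x with
      | zero => simp
      | add s t hs ht => simp only [smul_add, TensorProduct.add_tmul, map_add, hs, ht]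
      | tmul x x' => simp
  rw [coaction_self, rightConvolution, LinearMap.comp_apply, LinearMap.comp_apply]
  refine (h _).trans ?_
  rw [Coalgebra.coassoc_apply, ← LinearMap.comp_apply, ← LinearMap.lTensor_comp]
  rfl

end Average

variable {A H : Type*} [Ring A] [HopfAlgebra ℂ A] [Ring H] [HopfAlgebra ℂ H] (π : A →ₐc[ℂ] H)
  {h : H →ₗ[ℂ] ℂ}

theorem IsHaarFunctional.map_rightConvolution (hh : IsHaarFunctional h) (a : A) :
    π (rightConvolution (h ∘ₗ (π : A →ₗ[ℂ] H)) a) = h (π a) • 1 := by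
  have hrid (t : A ⊗[ℂ] A) :
      π (TensorProduct.rid ℂ A ((h ∘ₗ (π : A →ₗ[ℂ] H)).lTensor A t)) =
        TensorProduct.rid ℂ H (h.lTensor H (TensorProduct.map (π : A →ₗ[ℂ] H) π t)) := by
    induction t with
    | zero => simp
    | add s t hs ht => simp only [map_add, hs, ht]
    | tmul x y => simp
  refine (hrid _).trans ?_
  rw [CoalgHomClass.map_comp_comul_apply, hh.lTensor_comul, TensorProduct.rid_tmul]

theorem IsHaarFunctional.rightConvolution_mem_coinvariants (hh : IsHaarFunctional h) (a : A) :
    rightConvolution (h ∘ₗ (π : A →ₗ[ℂ] H)) a ∈ coinvariants π := by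
  have hπ : (π : A →ₗ[ℂ] H) ∘ₗ rightConvolution (h ∘ₗ (π : A →ₗ[ℂ] H)) =
      LinearMap.toSpanSingleton ℂ H 1 ∘ₗ h ∘ₗ (π : A →ₗ[ℂ] H) :=
    LinearMap.ext (hh.map_rightConvolution π)
  have hrid (t : A ⊗[ℂ] ℂ) : (LinearMap.toSpanSingleton ℂ H 1).lTensor A t =
      TensorProduct.rid ℂ A t ⊗ₜ 1 := by
    induction t with
    | zero => simp
    | add s t hs ht => simp only [map_add, TensorProduct.add_tmul, hs, ht]
    | tmul x c => simp [TensorProduct.smul_tmul]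
  rw [mem_coinvariants, ← coaction_self, rightConvolution_covariant, ← LinearMap.comp_apply,
    ← LinearMap.lTensor_comp, hπ, LinearMap.lTensor_comp, LinearMap.comp_apply, hrid]
  rfl

theorem rightConvolution_eq_rid_rightCoaction (a : A) :
    rightConvolution (h ∘ₗ (π : A →ₗ[ℂ] H)) a =
      TensorProduct.rid ℂ A (h.lTensor A (rightCoaction π a)) := by
  rw [rightConvolution, LinearMap.lTensor_comp]
  rfl

theorem rightConvolution_mul_left {b : A} (hb : b ∈ coinvariants π) (a : A) :
    rightConvolution (h ∘ₗ (π : A →ₗ[ℂ] H)) (b * a) =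
      b * rightConvolution (h ∘ₗ (π : A →ₗ[ℂ] H)) a := by
  have hb' : rightCoaction π b = b ⊗ₜ 1 := hb
  rw [rightConvolution_eq_rid_rightCoaction, rightConvolution_eq_rid_rightCoaction, map_mul, hb']
  induction rightCoaction π a with
  | zero => simp
  | add s t hs ht => simp only [mul_add, map_add, hs, ht]
  | tmul x y => simp

theorem rightConvolution_mul_right (a : A) {b : A} (hb : b ∈ coinvariants π) :
    rightConvolution (h ∘ₗ (π : A →ₗ[ℂ] H)) (a * b) =
      rightConvolution (h ∘ₗ (π : A →ₗ[ℂ] H)) a * b := by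
  have hb' : rightCoaction π b = b ⊗ₜ 1 := hb
  rw [rightConvolution_eq_rid_rightCoaction, rightConvolution_eq_rid_rightCoaction, map_mul, hb']
  induction rightCoaction π a with
  | zero => simp
  | add s t hs ht => simp only [add_mul, map_add, hs, ht]
  | tmul x y => simp

theorem coinvariants_val_covariant : IsCovariantMap A (coinvariants π).val.toLinearMap :=
  fun b => (coinvIncl_coinvCoact π b).symm

theorem IsHaarFunctional.exists_isConditionalExpectation (hh : IsHaarFunctional h) :
    ∃ E : A →ₗ[ℂ] coinvariants π, IsConditionalExpectation (coinvariants π).val E := by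
  let E : A →ₗ[ℂ] coinvariants π := (rightConvolution (h ∘ₗ (π : A →ₗ[ℂ] H))).codRestrict
    (Subalgebra.toSubmodule (coinvariants π)) (hh.rightConvolution_mem_coinvariants π)
  refine ⟨E, ?_, fun b a => ?_, fun a b => ?_, fun a => ?_⟩
  · apply Subtype.ext
    change rightConvolution (h ∘ₗ (π : A →ₗ[ℂ] H)) 1 = 1
    simp [rightConvolution_eq_rid_rightCoaction, Algebra.TensorProduct.one_def, hh.map_one]
  · exact Subtype.ext (rightConvolution_mul_left π b.2 a)
  · exact Subtype.ext (rightConvolution_mul_right π a b.2)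
  · apply coinvIncl_injective π
    have hE : coinvIncl π ∘ₗ E.lTensor A =
        (rightConvolution (h ∘ₗ (π : A →ₗ[ℂ] H))).lTensor A := by
      rw [coinvIncl, ← LinearMap.lTensor_comp]
      rfl
    refine (coinvIncl_coinvCoact π (E a)).trans ?_
    exact (rightConvolution_covariant (h ∘ₗ (π : A →ₗ[ℂ] H)) a).trans
      (LinearMap.congr_fun hE _).symm

end ConditionalExpectation

section Untwisting

section Bialgebra

variable {A V : Type*} [Ring A] [Bialgebra ℂ A] [AddCommGroup V] [Module ℂ V]

theorem assoc_comul_smul (a : A) (t : A ⊗[ℂ] V) :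
    TensorProduct.assoc ℂ A A V (Coalgebra.comul.rTensor V (a • t)) =
      diagonal A (actL A (A ⊗[ℂ] V)) (Coalgebra.comul a)
        (TensorProduct.assoc ℂ A A V (Coalgebra.comul.rTensor V t)) := by
  induction t with
  | zero => simp
  | add s t hs ht => simp only [smul_add, map_add, hs, ht]
  | tmul b v =>
    simp only [TensorProduct.smul_tmul', smul_eq_mul, LinearMap.rTensor_tmul, Bialgebra.comul_mul]
    induction Coalgebra.comul (R := ℂ) a with
    | zero => simp
    | add p p' hp hp' =>
      simp only [add_mul, TensorProduct.add_tmul, map_add, hp, hp', LinearMap.add_apply]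
    | tmul x x' =>
      induction Coalgebra.comul (R := ℂ) b with
      | zero => simp
      | add q q' hq hq' => simp only [mul_add, TensorProduct.add_tmul, map_add, hq, hq']
      | tmul y y' => simp [TensorProduct.smul_tmul']

variable [LeftComodule A V]

/-- The `A`-linear endomorphism `a ⊗ v ↦ a f(v₍₋₁₎) ⊗ v₍₀₎` of `A ⊗ V`. -/
def twist (V : Type*) [AddCommGroup V] [Module ℂ V] [LeftComodule A V] (f : A →ₗ[ℂ] A) :
    A ⊗[ℂ] V →ₗ[A] A ⊗[ℂ] V :=
  TensorProduct.AlgebraTensorModule.lift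
    (LinearMap.toSpanSingleton A (V →ₗ[ℂ] A ⊗[ℂ] V) (f.rTensor V ∘ₗ coaction A V))

@[simp] theorem twist_tmul (f : A →ₗ[ℂ] A) (a : A) (v : V) :
    twist V f (a ⊗ₜ v) = a • f.rTensor V (coaction A V v) := rfl

theorem twist_rTensor (f g : A →ₗ[ℂ] A) (t : A ⊗[ℂ] V) :
    twist V f (g.rTensor V t) = (LinearMap.mul' ℂ A ∘ₗ TensorProduct.map g f).rTensor V
      ((TensorProduct.assoc ℂ A A V).symm ((coaction A V).lTensor A t)) := by
  induction t with
  | zero => simp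
  | add s t hs ht => simp only [map_add, hs, ht]
  | tmul a v =>
    simp only [LinearMap.rTensor_tmul, twist_tmul, LinearMap.lTensor_tmul]
    induction coaction A V v with
    | zero => simp
    | add s t hs ht => simp only [map_add, smul_add, TensorProduct.tmul_add, hs, ht]
    | tmul b v => simp [TensorProduct.smul_tmul']

theorem twist_comp_twist (f g : A →ₗ[ℂ] A) :
    twist V f ∘ₗ twist V g =
      twist V (LinearMap.mul' ℂ A ∘ₗ TensorProduct.map g f ∘ₗ Coalgebra.comul) := by
  ext v
  have hcoassoc : (TensorProduct.assoc ℂ A A V).symm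
      ((coaction A V).lTensor A (coaction A V v)) = Coalgebra.comul.rTensor V (coaction A V v) :=
    (LinearEquiv.symm_apply_eq _).2 (LeftComodule.coassoc v).symm
  simp [twist_rTensor, hcoassoc, LinearMap.rTensor_comp]

theorem twist_counit : twist V (Algebra.linearMap ℂ A ∘ₗ Coalgebra.counit) = LinearMap.id := by
  ext v
  have hcounit : Coalgebra.counit.rTensor V (coaction A V v) = 1 ⊗ₜ[ℂ] v := LeftComodule.counit v
  simp [LinearMap.rTensor_comp, hcounit]

end Bialgebra

section HopfAlgebra

variable (A V : Type*) [Ring A] [HopfAlgebra ℂ A] [AddCommGroup V] [Module ℂ V]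
  [LeftComodule A V]

/-- The untwisting `a ⊗ v ↦ a v₍₋₁₎ ⊗ v₍₀₎` of the diagonal coaction on `A ⊗ V`, with inverse
`a ⊗ v ↦ a S(v₍₋₁₎) ⊗ v₍₀₎`. -/
def coactionEquiv : A ⊗[ℂ] V ≃ₗ[A] A ⊗[ℂ] V :=
  LinearEquiv.ofLinearMap (twist V LinearMap.id) (twist V (HopfAlgebra.antipode ℂ))
    (by rw [twist_comp_twist, ← LinearMap.rTensor_def, HopfAlgebra.mul_antipode_rTensor_comul,
      twist_counit])
    (by rw [twist_comp_twist, ← LinearMap.lTensor_def, HopfAlgebra.mul_antipode_lTensor_comul,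
      twist_counit])

variable {A V}

@[simp] theorem coactionEquiv_tmul (a : A) (v : V) :
    coactionEquiv A V (a ⊗ₜ v) = a • coaction A V v := by
  change twist V LinearMap.id (a ⊗ₜ v) = _
  rw [twist_tmul, LinearMap.rTensor_id, LinearMap.id_apply]

theorem coactionEquiv_symm_tmul (a : A) (v : V) :
    (coactionEquiv A V).symm (a ⊗ₜ v) =
      a • (HopfAlgebra.antipode ℂ).rTensor V (coaction A V v) := rfl

@[simp] theorem coactionEquiv_symm_coaction (v : V) :
    (coactionEquiv A V).symm (coaction A V v) = 1 ⊗ₜ v := by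
  rw [LinearEquiv.symm_apply_eq, coactionEquiv_tmul, one_smul]

theorem diagonal_smul_coaction (x : A ⊗[ℂ] A) (y : A ⊗[ℂ] V) :
    diagonal A (actL A (A ⊗[ℂ] V)) x ((coaction A V).lTensor A y) =
      ((coactionEquiv A V).toLinearMap.restrictScalars ℂ).lTensor A
        (diagonal A (TensorProduct.mk ℂ A V) x y) := by
  induction x with
  | zero => simp
  | add x x' hx hx' => simp only [map_add, LinearMap.add_apply, hx, hx']
  | tmul a a' =>
    induction y with
    | zero => simp
    | add y y' hy hy' => simp only [map_add, hy, hy']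
    | tmul b v => simp

theorem assoc_comul_coactionEquiv_tmul (a : A) (v : V) :
    TensorProduct.assoc ℂ A A V (Coalgebra.comul.rTensor V (coactionEquiv A V (a ⊗ₜ v))) =
      ((coactionEquiv A V).toLinearMap.restrictScalars ℂ).lTensor A
        (diagonal A (TensorProduct.mk ℂ A V) (Coalgebra.comul a) (coaction A V v)) := by
  rw [coactionEquiv_tmul, assoc_comul_smul, ← diagonal_smul_coaction]
  exact congrArg _ (LeftComodule.coassoc v)

end HopfAlgebra

end Untwisting

section Averaging

section SmulVia

variable {B M : Type*} [Ring B] [Algebra ℂ B] [AddCommGroup M] [Module ℂ M] [Module B M]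
  [IsScalarTower ℂ B M]

/-- The map `x ⊗ m ↦ E(x) m` induced by a linear map `E` into an algebra acting on `M`. -/
def smulVia {X : Type*} [AddCommGroup X] [Module ℂ X] (E : X →ₗ[ℂ] B) (M : Type*)
    [AddCommGroup M] [Module ℂ M] [Module B M] [IsScalarTower ℂ B M] : X ⊗[ℂ] M →ₗ[ℂ] M :=
  TensorProduct.lift (actL B M ∘ₗ E)

@[simp] theorem smulVia_tmul {X : Type*} [AddCommGroup X] [Module ℂ X] (E : X →ₗ[ℂ] B) (x : X)
    (m : M) : smulVia E M (x ⊗ₜ m) = E x • m := rfl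

theorem lTensor_smulVia_diagonal {A : Type*} [Ring A] [Algebra ℂ A] (E : A →ₗ[ℂ] B)
    (x : A ⊗[ℂ] A) (y : A ⊗[ℂ] M) :
    (smulVia E M).lTensor A (diagonal A (TensorProduct.mk ℂ A M) x y) =
      diagonal A (actL B M) (E.lTensor A x) y := by
  induction x with
  | zero => simp
  | add x x' hx hx' => simp only [map_add, LinearMap.add_apply, hx, hx']
  | tmul a a' =>
    induction y with
    | zero => simp
    | add y y' hy hy' => simp only [map_add, hy, hy']
    | tmul c m => simp

end SmulVia

variable {A B : Type*} [Ring A] [HopfAlgebra ℂ A] [Ring B] [Algebra ℂ B]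

section LeftModule

variable {M : Type*} [AddCommGroup M] [Module ℂ M] [Module B M] [IsScalarTower ℂ B M]
  [LeftComodule A M]

/-- The map `a ⊗ m ↦ E(a S(m₍₋₁₎)) m₍₀₎`, a `B`-linear and `A`-colinear retraction of the coaction
`M → A ⊗ M` when `E` is a conditional expectation onto `B`. -/
def averaging (E : A →ₗ[ℂ] B) (M : Type*) [AddCommGroup M] [Module ℂ M] [Module B M]
    [IsScalarTower ℂ B M] [LeftComodule A M] : A ⊗[ℂ] M →ₗ[ℂ] M :=
  smulVia E M ∘ₗ (coactionEquiv A M).symm.toLinearMap.restrictScalars ℂ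

theorem averaging_apply (E : A →ₗ[ℂ] B) (t : A ⊗[ℂ] M) :
    averaging E M t = smulVia E M ((coactionEquiv A M).symm t) := rfl

theorem averaging_coactionEquiv (E : A →ₗ[ℂ] B) (t : A ⊗[ℂ] M) :
    averaging E M (coactionEquiv A M t) = smulVia E M t := by
  rw [averaging_apply, LinearEquiv.symm_apply_apply]

theorem map_averaging {N : Type*} [AddCommGroup N] [Module ℂ N] [Module B N] [IsScalarTower ℂ B N]
    [LeftComodule A N] {f : M →ₗ[ℂ] N} (hf : ∀ (b : B) m, f (b • m) = b • f m)
    (hf' : IsCovariantMap A f) (E : A →ₗ[ℂ] B) (t : A ⊗[ℂ] M) :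
    f (averaging E M t) = averaging E N (f.lTensor A t) := by
  obtain ⟨u, rfl⟩ := (coactionEquiv A M).surjective t
  rw [averaging_coactionEquiv]
  induction u with
  | zero => simp
  | add u v hu hv => simp only [map_add, hu, hv]
  | tmul a m =>
    have hlin (t : A ⊗[ℂ] M) : f.lTensor A (a • t) = a • f.lTensor A t :=
      (f.baseChange A).map_smul a t
    rw [coactionEquiv_tmul, hlin, ← hf', ← coactionEquiv_tmul, averaging_coactionEquiv,
      smulVia_tmul, smulVia_tmul, hf]

variable [LeftComoduleAlgebra A B] {ι : B →ₐ[ℂ] A} {E : A →ₗ[ℂ] B}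

theorem IsConditionalExpectation.averaging_coaction (hE : IsConditionalExpectation ι E) (m : M) :
    averaging E M (coaction A M m) = m := by
  rw [averaging_apply, coactionEquiv_symm_coaction, smulVia_tmul, hE.map_one, one_smul]

theorem IsConditionalExpectation.averaging_smul (hE : IsConditionalExpectation ι E) (b : B)
    (t : A ⊗[ℂ] M) : averaging E M (ι b • t) = b • averaging E M t := by
  rw [averaging_apply, averaging_apply, map_smul]
  induction (coactionEquiv A M).symm t with
  | zero => simp
  | add s t hs ht => simp only [smul_add, map_add, hs, ht]
  | tmul a m =>
    simp only [TensorProduct.smul_tmul', smul_eq_mul, smulVia_tmul, hE.map_mul_left, mul_smul]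

end LeftModule

section RelHopfBimodule

variable [LeftComoduleAlgebra A B]
  {M : Type*} [AddCommGroup M] [Module ℂ M] [Module B M] [Module Bᵐᵒᵖ M]
  [IsScalarTower ℂ B M] [IsScalarTower ℂ Bᵐᵒᵖ M] [SMulCommClass B Bᵐᵒᵖ M]
  [LeftComodule A M] [IsRelHopfBimodule A B M] {ι : B →ₐ[ℂ] A} {E : A →ₗ[ℂ] B}

theorem coactionEquiv_lTensor_op_smul (t : A ⊗[ℂ] M) (b : B) :
    coactionEquiv A M (((actR B M).flip b).lTensor A t) =
      diagonal A (actR B M) (coactionEquiv A M t) (coaction A B b) := by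
  induction t with
  | zero => simp
  | add s t hs ht => simp only [map_add, LinearMap.add_apply, hs, ht]
  | tmul a m =>
    have hlin (s : A ⊗[ℂ] M) (t : A ⊗[ℂ] B) :
        diagonal A (actR B M) (a • s) t = a • diagonal A (actR B M) s t := by
      induction s with
      | zero => simp
      | add s s' hs hs' => simp only [smul_add, map_add, LinearMap.add_apply, hs, hs']
      | tmul c m =>
        induction t with
        | zero => simp
        | add t t' ht ht' => simp only [map_add, smul_add, ht, ht']
        | tmul d b => simp [TensorProduct.smul_tmul', mul_assoc]
    simp [hlin, IsRelHopfBimodule.coaction_op_smul]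

theorem averaging_diagonal_op_smul (E : A →ₗ[ℂ] B) (t : A ⊗[ℂ] M) (b : B) :
    averaging E M (diagonal A (actR B M) t (coaction A B b)) =
      MulOpposite.op b • averaging E M t := by
  obtain ⟨u, rfl⟩ := (coactionEquiv A M).surjective t
  rw [← coactionEquiv_lTensor_op_smul, averaging_coactionEquiv, averaging_coactionEquiv]
  induction u with
  | zero => simp
  | add u v hu hv => simp only [map_add, smul_add, hu, hv]
  | tmul a m => simp [smul_comm (E a)]

theorem IsConditionalExpectation.coaction_averaging (hE : IsConditionalExpectation ι E)
    (t : A ⊗[ℂ] M) : coaction A M (averaging E M t) =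
      (averaging E M).lTensor A (TensorProduct.assoc ℂ A A M (Coalgebra.comul.rTensor M t)) := by
  obtain ⟨u, rfl⟩ := (coactionEquiv A M).surjective t
  rw [averaging_coactionEquiv]
  induction u with
  | zero => simp
  | add u v hu hv => simp only [map_add, hu, hv]
  | tmul a m =>
    have hcomp : averaging E M ∘ₗ (coactionEquiv A M).toLinearMap.restrictScalars ℂ =
        smulVia E M := LinearMap.ext (averaging_coactionEquiv E)
    rw [assoc_comul_coactionEquiv_tmul, ← LinearMap.lTensor_comp_apply, hcomp,
      lTensor_smulVia_diagonal, smulVia_tmul, IsRelHopfBimodule.coaction_smul, hE.covariant]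
    rfl

end RelHopfBimodule

end Averaging

section Fiber

section Augmentation

variable {B : Type*} [Ring B] [Algebra ℂ B] (χ : B →ₐ[ℂ] ℂ)

/-- The subspace `B⁺ M` of a left `B`-module `M`, where `B⁺` is the kernel of the character `χ`. -/
def augmentationSubmodule (M : Type*) [AddCommGroup M] [Module ℂ M] [Module B M] :
    Submodule ℂ M :=
  Submodule.span ℂ {x | ∃ (b : B) (m : M), χ b = 0 ∧ x = b • m}

/-- The fibre `M / B⁺ M` of a left `B`-module `M` at the character `χ`. -/
abbrev Fiber (M : Type*) [AddCommGroup M] [Module ℂ M] [Module B M] : Type _ :=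
  M ⧸ augmentationSubmodule χ M

/-- The inclusion `M B⁺ ⊆ B⁺ M` for a `B`-bimodule `M`, where `B⁺` is the kernel of `χ`. -/
def IsAugmentationNormal (M : Type*) [AddCommGroup M] [Module ℂ M] [Module B M]
    [Module Bᵐᵒᵖ M] : Prop :=
  ∀ (b : B) (m : M), χ b = 0 → MulOpposite.op b • m ∈ augmentationSubmodule χ M

variable {χ} {M : Type*} [AddCommGroup M] [Module ℂ M] [Module B M]

theorem smul_mem_augmentationSubmodule {b : B} (hb : χ b = 0) (m : M) :
    b • m ∈ augmentationSubmodule χ M :=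
  Submodule.subset_span ⟨b, m, hb, rfl⟩

theorem map_mem_augmentationSubmodule {N : Type*} [AddCommGroup N] [Module ℂ N] [Module B N]
    {f : M →ₗ[ℂ] N} (hf : ∀ (b : B) m, χ b = 0 → f (b • m) ∈ augmentationSubmodule χ N) {x : M}
    (hx : x ∈ augmentationSubmodule χ M) : f x ∈ augmentationSubmodule χ N := by
  refine (Submodule.span_le (p := (augmentationSubmodule χ N).comap f)).2 ?_ hx
  rintro _ ⟨b, m, hb, rfl⟩
  exact hf b m hb

theorem mkQ_augmentationSubmodule_smul [IsScalarTower ℂ B M] (b : B) (m : M) :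
    (augmentationSubmodule χ M).mkQ (b • m) = χ b • (augmentationSubmodule χ M).mkQ m := by
  rw [← map_smul, ← sub_eq_zero, ← map_sub, Submodule.mkQ_apply, Submodule.Quotient.mk_eq_zero,
    ← algebraMap_smul B, ← sub_smul]
  exact smul_mem_augmentationSubmodule (by simp) m

variable [Module Bᵐᵒᵖ M]

theorem IsAugmentationNormal.mkQ_op_smul [IsScalarTower ℂ Bᵐᵒᵖ M]
    (hM : IsAugmentationNormal χ M) (b : B) (m : M) :
    (augmentationSubmodule χ M).mkQ (MulOpposite.op b • m) =
      χ b • (augmentationSubmodule χ M).mkQ m := by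
  rw [← map_smul, ← sub_eq_zero, ← map_sub, Submodule.mkQ_apply, Submodule.Quotient.mk_eq_zero,
    ← algebraMap_smul Bᵐᵒᵖ, ← sub_smul, MulOpposite.algebraMap_apply, ← MulOpposite.op_sub]
  exact hM _ m (by simp)

theorem IsAugmentationNormal.of_surjective {N : Type*} [AddCommGroup N] [Module ℂ N] [Module B N]
    [Module Bᵐᵒᵖ N] (hM : IsAugmentationNormal χ M) {f : M →ₗ[ℂ] N}
    (hf : ∀ (b : B) m, f (b • m) = b • f m)
    (hf' : ∀ (b : B) m, f (MulOpposite.op b • m) = MulOpposite.op b • f m)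
    (hsurj : Function.Surjective f) : IsAugmentationNormal χ N := by
  intro b n hb
  obtain ⟨m, rfl⟩ := hsurj n
  rw [← hf']
  exact map_mem_augmentationSubmodule
    (fun c x hc => hf c x ▸ smul_mem_augmentationSubmodule hc (f x)) (hM b m hb)

variable [IsScalarTower ℂ B M] [IsScalarTower ℂ Bᵐᵒᵖ M] [SMulCommClass B Bᵐᵒᵖ M]
  {N : Type*} [AddCommGroup N] [Module ℂ N] [Module B N] [Module Bᵐᵒᵖ N]
  [IsScalarTower ℂ B N] [IsScalarTower ℂ Bᵐᵒᵖ N] [SMulCommClass B Bᵐᵒᵖ N]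

theorem mk_mem_augmentationSubmodule_left {m : M} (hm : m ∈ augmentationSubmodule χ M) (n : N) :
    BTensor.mk B M N m n ∈ augmentationSubmodule χ (BTensor B M N) :=
  map_mem_augmentationSubmodule (f := (BTensor.mk B M N).flip n)
    (fun b x hb => by
      rw [LinearMap.flip_apply, ← BTensor.smul_mk]
      exact smul_mem_augmentationSubmodule hb _) hm

theorem IsAugmentationNormal.mk_mem_augmentationSubmodule_right (hM : IsAugmentationNormal χ M)
    (m : M) {n : N} (hn : n ∈ augmentationSubmodule χ N) :
    BTensor.mk B M N m n ∈ augmentationSubmodule χ (BTensor B M N) :=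
  map_mem_augmentationSubmodule (f := BTensor.mk B M N m)
    (fun b x hb => by
      rw [← BTensor.mk_balanced]
      exact mk_mem_augmentationSubmodule_left (hM b m hb) x) hn

theorem IsAugmentationNormal.bTensor (hM : IsAugmentationNormal χ M)
    (hN : IsAugmentationNormal χ N) : IsAugmentationNormal χ (BTensor B M N) := by
  intro b t hb
  induction t using BTensor.induction_on with
  | zero => simp
  | add s t hs ht => simpa only [smul_add] using add_mem hs ht
  | tmul m n =>
    rw [BTensor.op_smul_mk]
    exact hM.mk_mem_augmentationSubmodule_right m (hN b n hb)

end Augmentation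

section Quotient

variable {A B : Type*} [Ring A] [Algebra ℂ A] [Ring B] [Algebra ℂ B] {χ : B →ₐ[ℂ] ℂ}
  {M : Type*} [AddCommGroup M] [Module ℂ M] [Module B M]

theorem lTensor_mkQ_diagonal_smul [IsScalarTower ℂ B M] (x : A ⊗[ℂ] B) (y : A ⊗[ℂ] M) :
    (augmentationSubmodule χ M).mkQ.lTensor A (diagonal A (actL B M) x y) =
      TensorProduct.rid ℂ A (χ.toLinearMap.lTensor A x) •
        (augmentationSubmodule χ M).mkQ.lTensor A y := by
  induction x with
  | zero => simp
  | add x x' hx hx' => simp only [map_add, LinearMap.add_apply, add_smul, hx, hx']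
  | tmul a b =>
    induction y with
    | zero => simp
    | add y y' hy hy' => simp only [map_add, smul_add, hy, hy']
    | tmul c m =>
      simp [mkQ_augmentationSubmodule_smul, TensorProduct.smul_tmul', TensorProduct.tmul_smul,
        -Submodule.mkQ_apply]

theorem IsAugmentationNormal.lTensor_mkQ_diagonal_op_smul [Module Bᵐᵒᵖ M] [IsScalarTower ℂ Bᵐᵒᵖ M]
    (hM : IsAugmentationNormal χ M) (y : A ⊗[ℂ] M) (x : A ⊗[ℂ] B) :
    (augmentationSubmodule χ M).mkQ.lTensor A (diagonal A (actR B M) y x) =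
      (LinearMap.mulRight ℂ (TensorProduct.rid ℂ A (χ.toLinearMap.lTensor A x))).rTensor _
        ((augmentationSubmodule χ M).mkQ.lTensor A y) := by
  induction y with
  | zero => simp
  | add y y' hy hy' => simp only [map_add, LinearMap.add_apply, hy, hy']
  | tmul c m =>
    induction x with
    | zero => simp
    | add x x' hx hx' => simp [hx, hx', mul_add, TensorProduct.add_tmul, -Submodule.mkQ_apply]
    | tmul a b =>
      simp [hM.mkQ_op_smul, TensorProduct.smul_tmul', TensorProduct.tmul_smul, -Submodule.mkQ_apply]

end Quotient

end Fiber

section Splitting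

/-- The restriction of the counit of `A` along `ι : B → A`; its kernel is the ideal written `B⁺`
when `ι` is an inclusion. -/
def counitAlong {A B : Type*} [Ring A] [Bialgebra ℂ A] [Ring B] [Algebra ℂ B] (ι : B →ₐ[ℂ] A) :
    B →ₐ[ℂ] ℂ :=
  (Bialgebra.counitAlgHom ℂ A).comp ι

section FiberCoaction

variable {A B : Type*} [Ring A] [Bialgebra ℂ A] [Ring B] [Algebra ℂ B]

/-- The map `m ↦ m₍₋₁₎ ⊗ [m₍₀₎]` from `M` to the cofree comodule on its fibre. -/
def fiberCoaction (χ : B →ₐ[ℂ] ℂ) (M : Type*) [AddCommGroup M] [Module ℂ M] [Module B M]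
    [LeftComodule A M] : M →ₗ[ℂ] A ⊗[ℂ] Fiber χ M :=
  (augmentationSubmodule χ M).mkQ.lTensor A ∘ₗ coaction A M

theorem assoc_comul_fiberCoaction (χ : B →ₐ[ℂ] ℂ) {M : Type*} [AddCommGroup M] [Module ℂ M]
    [Module B M] [LeftComodule A M] (m : M) :
    TensorProduct.assoc ℂ A A (Fiber χ M) (Coalgebra.comul.rTensor _ (fiberCoaction χ M m)) =
      (fiberCoaction χ M).lTensor A (coaction A M m) := by
  have hcoassoc : TensorProduct.assoc ℂ A A M (Coalgebra.comul.rTensor M (coaction A M m)) =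
      (coaction A M).lTensor A (coaction A M m) := LeftComodule.coassoc m
  rw [fiberCoaction, LinearMap.comp_apply, assoc_rTensor_lTensor, hcoassoc,
    LinearMap.lTensor_comp, LinearMap.comp_apply]

variable [LeftComoduleAlgebra A B] {ι : B →ₐ[ℂ] A}

theorem rid_lTensor_counitAlong_coaction (hι : IsCovariantMap A ι.toLinearMap) (b : B) :
    TensorProduct.rid ℂ A ((counitAlong ι).toLinearMap.lTensor A (coaction A B b)) = ι b := by
  have hcomp : (counitAlong ι).toLinearMap = Coalgebra.counit ∘ₗ ι.toLinearMap := rfl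
  rw [hcomp, LinearMap.lTensor_comp, LinearMap.comp_apply, ← hι, coaction_self,
    Coalgebra.lTensor_counit_comul]
  simp

variable {M : Type*} [AddCommGroup M] [Module ℂ M] [Module B M] [Module Bᵐᵒᵖ M]
  [IsScalarTower ℂ B M] [IsScalarTower ℂ Bᵐᵒᵖ M] [SMulCommClass B Bᵐᵒᵖ M]
  [LeftComodule A M] [IsRelHopfBimodule A B M]

theorem fiberCoaction_smul (hι : IsCovariantMap A ι.toLinearMap) (b : B) (m : M) :
    fiberCoaction (counitAlong ι) M (b • m) = ι b • fiberCoaction (A := A) (counitAlong ι) M m := by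
  rw [fiberCoaction, LinearMap.comp_apply, IsRelHopfBimodule.coaction_smul,
    lTensor_mkQ_diagonal_smul, rid_lTensor_counitAlong_coaction hι, LinearMap.comp_apply]

theorem fiberCoaction_op_smul (hι : IsCovariantMap A ι.toLinearMap)
    (hM : IsAugmentationNormal (counitAlong ι) M) (b : B) (m : M) :
    fiberCoaction (counitAlong ι) M (MulOpposite.op b • m) =
      (LinearMap.mulRight ℂ (ι b)).rTensor _ (fiberCoaction (counitAlong ι) M m) := by
  rw [fiberCoaction, LinearMap.comp_apply, IsRelHopfBimodule.coaction_op_smul,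
    hM.lTensor_mkQ_diagonal_op_smul, rid_lTensor_counitAlong_coaction hι, LinearMap.comp_apply]

end FiberCoaction

section Descent

variable {A B : Type*} [Ring A] [HopfAlgebra ℂ A] [Ring B] [Algebra ℂ B] [LeftComoduleAlgebra A B]
  {M : Type*} [AddCommGroup M] [Module ℂ M] [Module B M] [IsScalarTower ℂ B M]
  {ι : B →ₐ[ℂ] A} {E : A →ₗ[ℂ] B}

theorem IsConditionalExpectation.smulVia_smul_antipode_diagonal
    (hE : IsConditionalExpectation ι E) (a : A) (x : A ⊗[ℂ] B) (y : A ⊗[ℂ] M) :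
    smulVia E M (a • (HopfAlgebra.antipode ℂ).rTensor M (diagonal A (actL B M) x y)) =
      smulVia E M (a • (LinearMap.mulRight ℂ (LinearMap.mul' ℂ A
        (TensorProduct.map (HopfAlgebra.antipode ℂ) ι.toLinearMap x))).rTensor M
          ((HopfAlgebra.antipode ℂ).rTensor M y)) := by
  induction y with
  | zero => simp
  | add y y' hy hy' => simp only [map_add, smul_add, hy, hy']
  | tmul c m =>
    induction x with
    | zero => simp
    | add x x' hx hx' =>
      simp [hx, hx', mul_add, TensorProduct.add_tmul, TensorProduct.smul_tmul']
    | tmul d b =>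
      simp [TensorProduct.smul_tmul', HopfAlgebra.antipode_mul_antidistrib, ← mul_assoc,
        hE.map_mul_right, mul_smul]

variable [Module Bᵐᵒᵖ M] [IsScalarTower ℂ Bᵐᵒᵖ M] [SMulCommClass B Bᵐᵒᵖ M]
  [LeftComodule A M] [IsRelHopfBimodule A B M]

namespace IsConditionalExpectation

theorem averaging_tmul_smul (hE : IsConditionalExpectation ι E)
    (hι : IsCovariantMap A ι.toLinearMap) (a : A) (b : B) (m : M) :
    averaging E M (a ⊗ₜ (b • m)) = counitAlong ι b • averaging E M (a ⊗ₜ m) := by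
  have hantipode : LinearMap.mul' ℂ A
      (TensorProduct.map (HopfAlgebra.antipode ℂ) ι.toLinearMap (coaction A B b)) =
        algebraMap ℂ A (counitAlong ι b) := by
    rw [← LinearMap.rTensor_comp_lTensor, LinearMap.comp_apply, ← hι, coaction_self]
    exact HopfAlgebra.mul_antipode_rTensor_comul_apply (ι b)
  have hscalar (z : ℂ) : LinearMap.mulRight ℂ (algebraMap ℂ A z) = z • LinearMap.id := by
    ext x
    simp [Algebra.smul_def, Algebra.commutes]
  rw [averaging_apply, averaging_apply, coactionEquiv_symm_tmul, coactionEquiv_symm_tmul,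
    IsRelHopfBimodule.coaction_smul, hE.smulVia_smul_antipode_diagonal, hantipode, hscalar,
    LinearMap.rTensor_smul, LinearMap.smul_apply, LinearMap.rTensor_id, LinearMap.id_apply,
    smul_comm, map_smul]

theorem averaging_eq_of_lTensor_mkQ_eq (hE : IsConditionalExpectation ι E)
    (hι : IsCovariantMap A ι.toLinearMap) {s t : A ⊗[ℂ] M}
    (hst : (augmentationSubmodule (counitAlong ι) M).mkQ.lTensor A s =
      (augmentationSubmodule (counitAlong ι) M).mkQ.lTensor A t) :
    averaging E M s = averaging E M t := by
  have hvanish (a : A) {m : M} (hm : m ∈ augmentationSubmodule (counitAlong ι) M) :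
      averaging E M (a ⊗ₜ m) = 0 := by
    induction hm using Submodule.span_induction with
    | zero => simp
    | add x y _ _ hx hy => rw [TensorProduct.tmul_add, map_add, hx, hy, add_zero]
    | smul z x _ hx => rw [TensorProduct.tmul_smul, map_smul, hx, smul_zero]
    | mem x hx =>
      obtain ⟨b, m, hb, rfl⟩ := hx
      rw [hE.averaging_tmul_smul hι, hb, zero_smul]
  have hcomp : averaging E M ∘ₗ (augmentationSubmodule (counitAlong ι) M).subtype.lTensor A = 0 :=
    TensorProduct.ext' fun a m => hvanish a m.2
  rw [← sub_eq_zero, ← map_sub] at hst ⊢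
  obtain ⟨u, hu⟩ := (lTensor_exact A (LinearMap.exact_subtype_mkQ _)
    (Submodule.mkQ_surjective _) _).1 hst
  rw [← hu]
  exact LinearMap.congr_fun hcomp u

theorem averaging_rTensor_mulRight (hE : IsConditionalExpectation ι E)
    (hι : IsCovariantMap A ι.toLinearMap) (hM : IsAugmentationNormal (counitAlong ι) M)
    (t : A ⊗[ℂ] M) (b : B) :
    averaging E M ((LinearMap.mulRight ℂ (ι b)).rTensor M t) =
      MulOpposite.op b • averaging E M t := by
  rw [← averaging_diagonal_op_smul]
  apply hE.averaging_eq_of_lTensor_mkQ_eq hι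
  rw [hM.lTensor_mkQ_diagonal_op_smul, rid_lTensor_counitAlong_coaction hι,
    ← LinearMap.comp_apply, ← LinearMap.comp_apply, LinearMap.lTensor_comp_rTensor,
    LinearMap.rTensor_comp_lTensor]

end IsConditionalExpectation

end Descent

section FiberLift

variable {A B : Type*} [Ring A] [HopfAlgebra ℂ A] [Ring B] [Algebra ℂ B] [LeftComoduleAlgebra A B]
  {M N : Type*} [AddCommGroup M] [Module ℂ M] [Module B M] [Module Bᵐᵒᵖ M]
  [IsScalarTower ℂ B M] [LeftComodule A M]
  [AddCommGroup N] [Module ℂ N] [Module B N] [Module Bᵐᵒᵖ N]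
  [IsScalarTower ℂ B N] [IsScalarTower ℂ Bᵐᵒᵖ N] [SMulCommClass B Bᵐᵒᵖ N]
  [LeftComodule A N] [IsRelHopfBimodule A B N]

/-- The map `n ↦ E(n₍₋₁₎ S(T[n₍₀₎]₍₋₁₎)) T[n₍₀₎]₍₀₎` obtained by averaging a linear map `T` from the
fibre of `N` to `M`. -/
def fiberLift (E : A →ₗ[ℂ] B) {χ : B →ₐ[ℂ] ℂ} (T : Fiber χ N →ₗ[ℂ] M) : N →ₗ[ℂ] M :=
  averaging E M ∘ₗ T.lTensor A ∘ₗ fiberCoaction χ N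

variable {ι : B →ₐ[ℂ] A} {E : A →ₗ[ℂ] B}

theorem IsConditionalExpectation.map_fiberLift (hE : IsConditionalExpectation ι E)
    (hι : IsCovariantMap A ι.toLinearMap) {f : M →ₗ[ℂ] N} (hf : IsRelHopfMorphism A B f)
    {T : Fiber (counitAlong ι) N →ₗ[ℂ] M}
    (hT : ((augmentationSubmodule (counitAlong ι) N).mkQ ∘ₗ f) ∘ₗ T = LinearMap.id) (n : N) :
    f (fiberLift E T n) = n := by
  rw [fiberLift, LinearMap.comp_apply, map_averaging hf.map_smul hf.covariant]
  refine (hE.averaging_eq_of_lTensor_mkQ_eq hι ?_).trans (hE.averaging_coaction n)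
  rw [LinearMap.comp_apply, ← LinearMap.lTensor_comp_apply, ← LinearMap.lTensor_comp_apply,
    hT, LinearMap.lTensor_id]
  rfl

variable [IsScalarTower ℂ Bᵐᵒᵖ M] [SMulCommClass B Bᵐᵒᵖ M] [IsRelHopfBimodule A B M]

theorem IsConditionalExpectation.fiberLift_isRelHopfMorphism (hE : IsConditionalExpectation ι E)
    (hι : IsCovariantMap A ι.toLinearMap) (hM : IsAugmentationNormal (counitAlong ι) M)
    (hN : IsAugmentationNormal (counitAlong ι) N) (T : Fiber (counitAlong ι) N →ₗ[ℂ] M) :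
    IsRelHopfMorphism A B (fiberLift E T) where
  map_smul b n := by
    have hlin (a : A) (t : A ⊗[ℂ] Fiber (counitAlong ι) N) :
        T.lTensor A (a • t) = a • T.lTensor A t := (T.baseChange A).map_smul a t
    simp only [fiberLift, LinearMap.comp_apply, fiberCoaction_smul hι, hlin, hE.averaging_smul]
  map_op_smul b n := by
    simp only [fiberLift, LinearMap.comp_apply, fiberCoaction_op_smul hι hN]
    rw [← hE.averaging_rTensor_mulRight hι hM, ← LinearMap.comp_apply (LinearMap.lTensor A T),
      ← LinearMap.comp_apply (LinearMap.rTensor M _), LinearMap.lTensor_comp_rTensor,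
      LinearMap.rTensor_comp_lTensor]
  covariant n := by
    simp only [fiberLift, LinearMap.comp_apply, LinearMap.lTensor_comp, hE.coaction_averaging,
      assoc_rTensor_lTensor, assoc_comul_fiberCoaction]

theorem IsConditionalExpectation.exists_section (hE : IsConditionalExpectation ι E)
    (hι : IsCovariantMap A ι.toLinearMap) (hM : IsAugmentationNormal (counitAlong ι) M)
    {f : M →ₗ[ℂ] N} (hf : IsRelHopfMorphism A B f) (hsurj : Function.Surjective f) :
    ∃ s : N →ₗ[ℂ] M, IsRelHopfMorphism A B s ∧ f ∘ₗ s = LinearMap.id := by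
  obtain ⟨T, hT⟩ := LinearMap.exists_rightInverse_of_surjective
    ((augmentationSubmodule (counitAlong ι) N).mkQ ∘ₗ f)
    (LinearMap.range_eq_top.2 ((Submodule.mkQ_surjective _).comp hsurj))
  exact ⟨fiberLift E T, hE.fiberLift_isRelHopfMorphism hι hM
    (hM.of_surjective hf.map_smul hf.map_op_smul hsurj) T,
    LinearMap.ext (hE.map_fiberLift hι hf hT)⟩

end FiberLift

end Splitting

section Calculus

theorem coe_decompose_one_add_mem_mul {R Ω : Type*} [CommRing R] [Ring Ω] [Algebra R Ω]
    (𝒜 : ℕ → Submodule R Ω) [GradedAlgebra 𝒜] (k : ℕ) {x y : Ω}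
    (hx : x ∈ Algebra.adjoin R (𝒜 0 ∪ 𝒜 1 : Set Ω))
    (hy : (DirectSum.decompose 𝒜 y (1 + k) : Ω) ∈ 𝒜 1 * 𝒜 k) :
    (DirectSum.decompose 𝒜 (x * y) (1 + k) : Ω) ∈ 𝒜 1 * 𝒜 k := by
  induction hx using Algebra.adjoin_induction generalizing y with
  | algebraMap r =>
    rw [← Algebra.smul_def, DirectSum.decompose_smul]
    exact Submodule.smul_mem _ r hy
  | add x x' _ _ hx hx' =>
    rw [add_mul, DirectSum.decompose_add]
    exact add_mem (hx hy) (hx' hy)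
  | mul x x' _ _ hx hx' =>
    rw [mul_assoc]
    exact hx (hx' hy)
  | mem x hx =>
    rcases hx with hx | hx
    · have hle : 𝒜 0 * (𝒜 1 * 𝒜 k) ≤ 𝒜 1 * 𝒜 k := by
        rw [← mul_assoc]
        gcongr
        exact Submodule.mul_le.2 fun a ha b hb => by simpa using SetLike.mul_mem_graded ha hb
      rw [DirectSum.coe_decompose_mul_of_left_mem_zero 𝒜 hx]
      exact hle (Submodule.mul_mem_mul hx hy)
    · rw [DirectSum.coe_decompose_mul_of_left_mem_of_le 𝒜 hx (Nat.le_add_right 1 k),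
        Nat.add_sub_cancel_left]
      exact Submodule.mul_mem_mul hx (DirectSum.decompose 𝒜 y k).2

theorem graded_one_add_le_mul {R Ω : Type*} [CommRing R] [Ring Ω] [Algebra R Ω]
    (𝒜 : ℕ → Submodule R Ω) [GradedAlgebra 𝒜]
    (hgen : Algebra.adjoin R (𝒜 0 ∪ 𝒜 1 : Set Ω) = ⊤) (k : ℕ) : 𝒜 (1 + k) ≤ 𝒜 1 * 𝒜 k := by
  intro ω hω
  have hone : (DirectSum.decompose 𝒜 1 (1 + k) : Ω) ∈ 𝒜 1 * 𝒜 k := by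
    rw [DirectSum.decompose_of_mem_ne 𝒜 SetLike.GradedOne.one_mem (by lia)]
    exact zero_mem _
  have hωone := coe_decompose_one_add_mem_mul 𝒜 k (hgen ▸ Algebra.mem_top (x := ω)) hone
  rwa [mul_one, DirectSum.decompose_of_mem_same 𝒜 hω] at hωone

namespace DifferentialCalculus

variable {B : Type*} [Ring B] [Algebra ℂ B] {Ω : Type*} [Ring Ω] [Algebra ℂ Ω]
  {deg : ℕ → Submodule ℂ Ω} [GradedAlgebra deg] (C : DifferentialCalculus B deg)

include C in
theorem adjoin_zero_union_one : Algebra.adjoin ℂ (deg 0 ∪ deg 1 : Set Ω) = ⊤ := by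
  refine top_unique (C.adjoin_eq_top.ge.trans (Algebra.adjoin_mono (Set.union_subset_union ?_ ?_)))
  · exact Set.range_subset_iff.2 C.ofB_mem
  · exact Set.range_subset_iff.2 fun b => C.d_mem 0 _ (C.ofB_mem b)

theorem mul_le_map_range_wedge (k l : ℕ) :
    deg k * deg l ≤ (LinearMap.range (C.wedge k l)).map (C.incl (k + l)) :=
  Submodule.mul_le.2 fun ω hω η hη =>
    ⟨_, ⟨BTensor.mk B (C.Form k) (C.Form l) ⟨ω, hω⟩ ⟨η, hη⟩, rfl⟩,
      congrArg (C.incl (k + l)) (BTensor.lift_mk B _ _ _ _)⟩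

theorem wedge_one_surjective (k : ℕ) : Function.Surjective (C.wedge 1 k) := by
  intro ω
  obtain ⟨_, ⟨t, rfl⟩, ht⟩ := C.mul_le_map_range_wedge 1 k
    (graded_one_add_le_mul deg C.adjoin_zero_union_one k ω.2)
  exact ⟨t, C.incl_injective (1 + k) ht⟩

end DifferentialCalculus

end Calculus

end QHS

end

theorem mainTheorem7_general {A H : Type*} [Ring A] [HopfAlgebra ℂ A] [Ring H] [HopfAlgebra ℂ H]
    (π : A →ₐc[ℂ] H) (hcs : IsCosemisimple H)
    {Ω : Type*} [Ring Ω] [Algebra ℂ Ω] (deg : ℕ → Submodule ℂ Ω) [GradedAlgebra deg]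
    (C : DifferentialCalculus (coinvariants π) deg)
    [∀ k, LeftComodule A (C.Form k)] [∀ k, IsRelHopfBimodule A (coinvariants π) (C.Form k)]
    (hwedge : IsRelHopfMorphism A (coinvariants π) (C.wedge 1 1))
    (hnormal : IsAugmentationNormal (counitAlong (coinvariants π).val) (C.Form 1)) :
    C.IsCovariantlyQuasiTame A := by
  obtain ⟨h, hh⟩ := hcs.exists_isHaarFunctional
  obtain ⟨E, hE⟩ := hh.exists_isConditionalExpectation π
  exact hE.exists_section (coinvariants_val_covariant π) (hnormal.bTensor hnormal) hwedge
    (C.wedge_one_surjective 1)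

theorem mainTheorem7 {A H : Type u} [Ring A] [HopfAlgebra ℂ A] [Ring H] [HopfAlgebra ℂ H]
    (hA : Function.Bijective (HopfAlgebra.antipode ℂ (A := A)))
    (hH : Function.Bijective (HopfAlgebra.antipode ℂ (A := H)))
    (π : A →ₐc[ℂ] H) (hB : IsQuantumHomogeneousSpace π) (hcs : IsCosemisimple H)
    {Ω : Type u} [Ring Ω] [Algebra ℂ Ω] (deg : ℕ → Submodule ℂ Ω) [GradedAlgebra deg]
    (C : DifferentialCalculus (coinvariants π) deg)
    [∀ k, LeftComodule A (C.Form k)] [∀ k, IsRelHopfBimodule A (coinvariants π) (C.Form k)]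
    (hC : C.IsCovariant A) (hzero : ∀ k, IsModZero π (C.Form k)) :
    C.IsCovariantlyQuasiTame A :=
  mainTheorem7_general π hcs deg C (hC.wedge_morphism 1 1) fun b ω hb =>
    (hzero 1).comm.le (Submodule.subset_span ⟨ω, b, hb, rfl⟩)
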